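/- Let $p>1$, $a\in\mathbb R$, $R\ge 1$, and let $f\in C^2(\mathbb R)$, $g\in C^1(\mathbb R)$ satisfy $\operatorname{supp} f,\ \operatorname{supp} g\subset\{x\in\mathbb R:|x|\le R\}$. Write $\langle x\rangle=(1+x^2)^{1/2}$, and for $\varepsilon>0$ consider the Cauchy problem $$u_{tt}-u_{xx}=\frac{|u_x|^p}{\langle x\rangle^a},\qquad u(x,0)=\varepsilon f(x),\quad u_t(x,0)=\varepsilon g(x)\qquad(x\in\mathbb R).\tag{1}$$ For $T\in(0,\infty]$, a classical solution of (1) on $[0,T)$ is a function $u$ of class $C^2$ on $\mathbb R\times[0,T)$ that satisfies the equation pointwise in $\mathbb R\times(0,T)$ and the initial conditions. We say that the classical solution of (1) exists on $[0,T)$ if there is one and only one such $u$. The lifespan is $$T(\varepsilon)=\sup\{T\in(0,\infty]:\ \text{the classical solution of (1) exists on }[0,T)\}.$$ Then there are constants $\varepsilon_2>0$ and $C>0$, depending only on $f,g,p,a,R$ (in particular not on $\varepsilon$), such that for all $\varepsilon\in(0,\varepsilon_2]$: - if $a<1$, the classical solution exists on $[0,T)$ for every $0<T\le C\varepsilon^{-(p-1)/(1-a)}$,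 so that $T(\varepsilon)\ge C\varepsilon^{-(p-1)/(1-a)}$; - if $a=1$, the classical solution exists on $[0,T)$ for every $0<T\le \exp\left(C\varepsilon^{-(p-1)}\right)$, so that $T(\varepsilon)\ge \exp\left(C\varepsilon^{-(p-1)}\right)$; - if $a>1$, the classical solution exists on $[0,T)$ for every $T\in(0,\infty]$; in particular it exists globally and $T(\varepsilon)=\infty$. -/

import Mathlib

open scoped ENNReal

noncomputable section

/-- The bracket `⟨x⟩ = (1 + x ^ 2) ^ (1 / 2)`. -/
def bracket (x : ℝ) : ℝ := Real.sqrt (1 + x ^ 2)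

/-- The space-time slab `ℝ × [0, T)`, with points written `(x, t)`; `T = ∞` is allowed. -/
def slab (T : ℝ≥0∞) : Set (ℝ × ℝ) := {q | 0 ≤ q.2 ∧ ENNReal.ofReal q.2 < T}

/-- `u` (as a function `u x t`) is a classical solution on the time interval `[0, T)` of
`u_tt - u_xx = |u_x| ^ p / ⟨x⟩ ^ a` with `u(x,0) = ε f(x)`, `u_t(x,0) = ε g(x)`:
it is of class `C²` on `ℝ × [0, T)` (up to the initial line), satisfies the equation
pointwise in `ℝ × (0, T)`, and takes the initial data; the time derivative at `t = 0` is one-sided.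
Values of `u` outside `ℝ × [0, T)` play no role. -/
structure IsClassicalSolution (p a ε : ℝ) (f g : ℝ → ℝ) (T : ℝ≥0∞) (u : ℝ → ℝ → ℝ) : Prop where
  contDiffOn : ContDiffOn ℝ 2 (fun q : ℝ × ℝ => u q.1 q.2) (slab T)
  equation : ∀ x t : ℝ, 0 < t → ENNReal.ofReal t < T →
    iteratedDeriv 2 (fun s => u x s) t - iteratedDeriv 2 (fun y => u y t) x
      = |deriv (fun y => u y t) x| ^ p / bracket x ^ a
  initial_value : ∀ x : ℝ, u x 0 = ε * f x
  initial_velocity : ∀ x : ℝ, derivWithin (fun s => u x s) (Set.Ici 0) 0 = ε * g x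

/-- "The classical solution exists on `[0, T)`": there is a classical solution, and any two of
them agree on `ℝ × [0, T)`. -/
def ClassicalSolutionExists (p a ε : ℝ) (f g : ℝ → ℝ) (T : ℝ≥0∞) : Prop :=
  (∃ u : ℝ → ℝ → ℝ, IsClassicalSolution p a ε f g T u) ∧
    ∀ u v : ℝ → ℝ → ℝ, IsClassicalSolution p a ε f g T u → IsClassicalSolution p a ε f g T v →
      ∀ x t : ℝ, 0 ≤ t → ENNReal.ofReal t < T → u x t = v x t

/-- The lifespan `T(ε)`: the supremum in `[0, ∞]` of all `T ∈ (0, ∞]` such that the classical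
solution exists on `[0, T)`. -/
def lifespan (p a ε : ℝ) (f g : ℝ → ℝ) : ℝ≥0∞ :=
  sSup {T : ℝ≥0∞ | 0 < T ∧ ClassicalSolutionExists p a ε f g T}

end

open MeasureTheory Set Filter Topology

/-! Only the slope `w = u_x` enters the nonlinearity. The Riemann invariants `u_t ± u_x` are
transported along the lines `x ± t = const` with source `|w|^p ⟨x⟩^{-a}`, so `w` solves a closed
integral equation: free slope plus half the difference of two integrals of the source along
characteristics. On a characteristic `x` moves at unit speed, so a weight `k(x)` contributes at most
`∫ |k|`, however large `t` is (`abs_duhamel_le`). Hence, if the nonlinearity has Lipschitz constant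
`Λ` and `Λ ∫ |k| ≤ 1/2`, the equation is a contraction for the sup norm on the whole plane
(`exists_fixedPoint_duhamel`), and its solution is at most twice as large as the free slope.

Two modifications make this applicable. The power `|s|^p` is changed beyond `|s| ≤ 2εm`, where `εm`
bounds the free slope; this gives `Λ = p (2εm)^(p-1)`, and the solution never sees the change. The
weight is cut off outside `|x| ≤ T + R` unless `a > 1`; finite speed of propagation
(`eq_zero_of_fixedPoint`) makes this harmless for times below `T`. The smallness condition becomes
`ε^(p-1) ∫_{|y| ≤ 2(T+R)} ⟨y⟩^{-a} dy ≲ 1`. The integral is `O(T^(1-a))`, `O(log T)` or bounded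
according as `a < 1`, `a = 1` or `a > 1`, which gives the three lifespans.

A fixed point is only continuous. Its `x`-derivative is the fixed point of the linearised equation
(`exists_hasDerivAt_fixedPoint`), and transport then gives `u` of class C²
(`exists_semilinear_wave`). Uniqueness among all classical solutions is a separate argument in
backward light cones (`IsClassicalSolution.fderivWithin_eq`). -/

/-! ### Calculus in the plane: smoothness from partial derivatives, parametric integrals. -/

theorem hasStrictFDerivAt_of_partials {F Fx Ft : ℝ × ℝ → ℝ} (hx : ∀ x t, HasDerivAt (fun y => F (y, t)) (Fx (x, t)) x)
    (ht : ∀ x t, HasDerivAt (fun s => F (x, s)) (Ft (x, t)) t)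
    (cx : Continuous Fx) (ct : Continuous Ft) (q : ℝ × ℝ) :
    HasStrictFDerivAt F ((ContinuousLinearMap.toSpanSingleton ℝ (Fx q)).coprod
      (ContinuousLinearMap.toSpanSingleton ℝ (Ft q))) q := by
  have := hasStrictFDerivAt_uncurry_coprod (𝕜 := ℝ) (u := q) (f := fun x t => F (x, t))
    (f₁ := fun x t => ContinuousLinearMap.toSpanSingleton ℝ (Fx (x, t)))
    (f₂ := fun x t => ContinuousLinearMap.toSpanSingleton ℝ (Ft (x, t)))
    (Eventually.of_forall fun v => (hx v.1 v.2).hasFDerivAt)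
    (Eventually.of_forall fun v => (ht v.1 v.2).hasFDerivAt)
    (by
      have : Continuous fun r : ℝ × ℝ => ContinuousLinearMap.toSpanSingleton ℝ (Fx r) :=
        (ContinuousLinearMap.toSpanSingletonCLE (𝕜 := ℝ) (E := ℝ)).continuous.comp cx
      exact this.continuousAt)
    (by
      have : Continuous fun r : ℝ × ℝ => ContinuousLinearMap.toSpanSingleton ℝ (Ft r) :=
        (ContinuousLinearMap.toSpanSingletonCLE (𝕜 := ℝ) (E := ℝ)).continuous.comp ct
      exact this.continuousAt)
  exact this

theorem contDiff_one_of_partials {F Fx Ft : ℝ × ℝ → ℝ}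
    (hx : ∀ x t, HasDerivAt (fun y => F (y, t)) (Fx (x, t)) x)
    (ht : ∀ x t, HasDerivAt (fun s => F (x, s)) (Ft (x, t)) t)
    (cx : Continuous Fx) (ct : Continuous Ft) : ContDiff ℝ 1 F := by
  rw [contDiff_one_iff_hasFDerivAt]
  refine ⟨_, ?_, fun q => (hasStrictFDerivAt_of_partials hx ht cx ct q).hasFDerivAt⟩
  rw [continuous_clm_apply]
  intro y
  simp only [ContinuousLinearMap.coprod_apply, ContinuousLinearMap.toSpanSingleton_apply]
  fun_prop

theorem contDiff_two_of_partials {F Fx Ft : ℝ × ℝ → ℝ}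
    (hx : ∀ x t, HasDerivAt (fun y => F (y, t)) (Fx (x, t)) x)
    (ht : ∀ x t, HasDerivAt (fun s => F (x, s)) (Ft (x, t)) t)
    (cx : ContDiff ℝ 1 Fx) (ct : ContDiff ℝ 1 Ft) : ContDiff ℝ 2 F := by
  have : ContDiff ℝ ((1 : ℕ) + 1) F := by
    rw [contDiff_succ_iff_hasFDerivAt]
    refine ⟨_, ?_, fun q =>
      (hasStrictFDerivAt_of_partials hx ht cx.continuous ct.continuous q).hasFDerivAt⟩
    rw [contDiff_clm_apply_iff]
    intro y
    simp only [ContinuousLinearMap.coprod_apply, ContinuousLinearMap.toSpanSingleton_apply]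
    exact ((contDiff_const (c := y.1)).smul cx).add ((contDiff_const (c := y.2)).smul ct)
  exact_mod_cast this

/-- Differentiation under the integral sign, for a jointly continuous partial derivative. -/
theorem hasDerivAt_integral_param {g gx : ℝ × ℝ → ℝ} (cg : Continuous g) (cgx : Continuous gx)
    (hg : ∀ x s, HasDerivAt (fun y => g (y, s)) (gx (x, s)) x) (x a b : ℝ) :
    HasDerivAt (fun y => ∫ s in a..b, g (y, s)) (∫ s in a..b, gx (x, s)) x := by
  obtain ⟨M, hM⟩ := ((isCompact_closedBall x 1).prod (isCompact_uIcc (a := a) (b := b))).exists_bound_of_continuousOn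
    cgx.continuousOn
  refine (intervalIntegral.hasDerivAt_integral_of_dominated_loc_of_deriv_le (F := fun y s => g (y, s))
    (F' := fun y s => gx (y, s)) (bound := fun _ => M)
    (Metric.closedBall_mem_nhds x one_pos) ?_ ?_ ?_ ?_ ?_ ?_).2
  · exact Eventually.of_forall fun y => (by fun_prop : Continuous fun s => g (y, s)).aestronglyMeasurable
  · exact (by fun_prop : Continuous fun s => g (x, s)).intervalIntegrable _ _
  · exact (by fun_prop : Continuous fun s => gx (x, s)).aestronglyMeasurable
  · exact Eventually.of_forall fun s hs y hy => hM (y, s) ⟨hy, uIoc_subset_uIcc hs⟩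
  · exact intervalIntegrable_const
  · exact Eventually.of_forall fun s _ y _ => hg y s

theorem continuous_integral_param {g : ℝ × ℝ → ℝ} (cg : Continuous g) :
    Continuous fun q : ℝ × ℝ => ∫ s in (0 : ℝ)..q.2, g (q.1, s) :=
  intervalIntegral.continuous_parametric_intervalIntegral_of_continuous
    (f := fun (q : ℝ × ℝ) s => g (q.1, s)) (by simp only [Function.uncurry_def]; fun_prop) continuous_snd

theorem hasDerivAt_integral_end {g : ℝ × ℝ → ℝ} (cg : Continuous g) (x t : ℝ) :
    HasDerivAt (fun r => ∫ s in (0 : ℝ)..r, g (x, s)) (g (x, t)) t :=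
  ((by fun_prop : Continuous fun s => g (x, s)).integral_hasStrictDerivAt 0 t).hasDerivAt

/-- Difference quotients of a `C¹` function converge locally uniformly. -/
theorem exists_taylor_bound {f : ℝ → ℝ} (hf : ContDiff ℝ 1 f) (N : ℝ) {η : ℝ} (hη : 0 < η) :
    ∃ δ₀ > 0, ∀ y δ, |y| ≤ N → |δ| ≤ δ₀ → |f (y + δ) - f y - δ * deriv f y| ≤ η * |δ| := by
  have hc : Continuous (deriv f) := hf.continuous_deriv le_rfl
  have hu := (isCompact_closedBall (0 : ℝ) (N + 1)).uniformContinuousOn_of_continuous hc.continuousOn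
  rw [Metric.uniformContinuousOn_iff] at hu
  obtain ⟨d, hd, hd'⟩ := hu η hη
  refine ⟨min (d / 2) 1, by positivity, fun y δ hy hδ => ?_⟩
  have h1 : |δ| ≤ 1 := hδ.trans (min_le_right _ _)
  have h2 : |δ| < d := by linarith [hδ.trans (min_le_left _ _)]
  have key := (convex_closedBall y |δ|).norm_image_sub_le_of_norm_hasDerivWithin_le
    (f := fun x => f x - x * deriv f y) (f' := fun x => deriv f x - 1 * deriv f y) (C := η) (x := y) (y := y + δ)
    (fun x _ => (((hf.differentiable one_ne_zero x).hasDerivAt).sub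
      ((hasDerivAt_id x).mul_const _)).hasDerivWithinAt)
    (fun x hx => by
      have hx' : |x - y| ≤ |δ| := by simpa [Real.dist_eq] using hx
      have hyn : |y| ≤ N + 1 := by linarith
      have hxn : |x| ≤ N + 1 := by
        have : |x| ≤ |x - y| + |y| := by simpa using abs_add_le (x - y) y
        linarith
      have := hd' x (by simpa using hxn) y (by simpa using hyn) (by rw [Real.dist_eq]; linarith)
      rw [Real.dist_eq] at this
      simpa using this.le)
    (by simp) (by simp)
  have e : f (y + δ) - f y - δ * deriv f y = (f (y + δ) - (y + δ) * deriv f y) - (f y - y * deriv f y) := by ring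
  rw [e]
  simpa using key

/-! ### The Duhamel operator along characteristics and its contraction principle. -/

/-- The `x`-derivative of Duhamel's integral for the wave operator with right-hand side `h`. -/
noncomputable def duhamel (h : ℝ × ℝ → ℝ) (q : ℝ × ℝ) : ℝ :=
  (∫ s in (0 : ℝ)..q.2, (h (q.1 + q.2 - s, s) - h (q.1 - q.2 + s, s))) / 2

theorem continuous_duhamel {h : ℝ × ℝ → ℝ} (hc : Continuous h) : Continuous (duhamel h) := by
  unfold duhamel
  refine Continuous.div_const ?_ _
  exact intervalIntegral.continuous_parametric_intervalIntegral_of_continuous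
    (f := fun (q : ℝ × ℝ) s => h (q.1 + q.2 - s, s) - h (q.1 - q.2 + s, s))
    (by simp only [Function.uncurry_def]; fun_prop) continuous_snd

theorem duhamel_sub {h₁ h₂ : ℝ × ℝ → ℝ} (h₁c : Continuous h₁) (h₂c : Continuous h₂) (q : ℝ × ℝ) :
    duhamel (fun r => h₁ r - h₂ r) q = duhamel h₁ q - duhamel h₂ q := by
  unfold duhamel
  rw [← sub_div, ← intervalIntegral.integral_sub]
  · congr 2; ext s; ring
  all_goals exact Continuous.intervalIntegrable (by fun_prop) _ _

theorem duhamel_add {h₁ h₂ : ℝ × ℝ → ℝ} (h₁c : Continuous h₁) (h₂c : Continuous h₂) (q : ℝ × ℝ) :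
    duhamel (fun r => h₁ r + h₂ r) q = duhamel h₁ q + duhamel h₂ q := by
  unfold duhamel
  rw [← add_div, ← intervalIntegral.integral_add]
  · congr 2; ext s; ring
  all_goals exact Continuous.intervalIntegrable (by fun_prop) _ _

theorem duhamel_const_mul (c : ℝ) (h : ℝ × ℝ → ℝ) (q : ℝ × ℝ) :
    duhamel (fun r => c * h r) q = c * duhamel h q := by
  unfold duhamel
  simp_rw [← mul_sub]
  rw [intervalIntegral.integral_const_mul, mul_div_assoc]

theorem duhamel_translate (h : ℝ × ℝ → ℝ) (δ : ℝ) (q : ℝ × ℝ) :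
    duhamel (fun r => h (r.1 + δ, r.2)) q = duhamel h (q.1 + δ, q.2) := by
  unfold duhamel
  congr 2
  ext s
  ring_nf

theorem abs_integral_interval_le {k : ℝ → ℝ} (hk : Integrable k) (a b : ℝ) :
    |∫ s in a..b, (|k s|)| ≤ ∫ y, |k y| := by
  refine (intervalIntegral.norm_integral_le_integral_norm_uIoc (f := fun s => |k s|)).trans ?_
  simp only [norm_abs_eq_norm, Real.norm_eq_abs]
  exact setIntegral_le_integral hk.abs (Eventually.of_forall fun _ => abs_nonneg _)

/-- Changing variables from `s` to position turns each characteristic integral of `|k|` into an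
integral over an interval, bounded by `∫ |k|` independently of time; two characteristics and the
factor `1/2` give `∫ |k|` once. The `Z₂` part has no spatial decay and costs the elapsed time. The
hypotheses concern only the two characteristics, so that the bound can be used in regions closed
under them. -/
theorem abs_duhamel_le {k : ℝ → ℝ} (hkc : Continuous k) (hk : Integrable k) {h : ℝ × ℝ → ℝ}
    {Z₁ Z₂ : ℝ} (hZ₁ : 0 ≤ Z₁) (hZ₂ : 0 ≤ Z₂) (q : ℝ × ℝ)
    (H₁ : ∀ s ∈ uIcc 0 q.2, |h (q.1 + q.2 - s, s)| ≤ |k (q.1 + q.2 - s)| * Z₁ + Z₂)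
    (H₂ : ∀ s ∈ uIcc 0 q.2, |h (q.1 - q.2 + s, s)| ≤ |k (q.1 - q.2 + s)| * Z₁ + Z₂) :
    |duhamel h q| ≤ (∫ y, |k y|) * Z₁ + |q.2| * Z₂ := by
  have hb : ‖∫ s in (0 : ℝ)..q.2, (h (q.1 + q.2 - s, s) - h (q.1 - q.2 + s, s))‖ ≤
      |∫ s in (0 : ℝ)..q.2, ((|k (q.1 + q.2 - s)| * Z₁ + |k (q.1 - q.2 + s)| * Z₁) + 2 * Z₂)| := by
    refine intervalIntegral.norm_integral_le_abs_of_norm_le ?_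
      (Continuous.intervalIntegrable (by fun_prop) _ _)
    refine (ae_restrict_iff' measurableSet_uIoc).2 (Eventually.of_forall fun s hs => ?_)
    have h1 := H₁ s (uIoc_subset_uIcc hs)
    have h2 := H₂ s (uIoc_subset_uIcc hs)
    have := abs_sub (h (q.1 + q.2 - s, s)) (h (q.1 - q.2 + s, s))
    rw [Real.norm_eq_abs]
    linarith
  rw [intervalIntegral.integral_add (Continuous.intervalIntegrable (by fun_prop) _ _)
    (Continuous.intervalIntegrable (by fun_prop) _ _),
    intervalIntegral.integral_add (Continuous.intervalIntegrable (by fun_prop) _ _)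
    (Continuous.intervalIntegrable (by fun_prop) _ _), intervalIntegral.integral_mul_const,
    intervalIntegral.integral_mul_const,
    intervalIntegral.integral_comp_sub_left (fun s => |k s|) (q.1 + q.2),
    intervalIntegral.integral_comp_add_left (fun s => |k s|) (q.1 - q.2),
    intervalIntegral.integral_const, Real.norm_eq_abs, smul_eq_mul] at hb
  have e1 := abs_integral_interval_le hk (q.1 + q.2 - q.2) (q.1 + q.2 - 0)
  have e2 := abs_integral_interval_le hk (q.1 - q.2 + 0) (q.1 - q.2 + q.2)
  have hb' := hb.trans ((abs_add_le _ _).trans (add_le_add_left (abs_add_le _ _) _))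
  rw [abs_mul, abs_mul, abs_mul, abs_of_nonneg hZ₁, abs_of_nonneg (by positivity : 0 ≤ 2 * Z₂)] at hb'
  simp only [sub_zero] at e1 hb'
  unfold duhamel
  rw [abs_div, abs_two, div_le_iff₀ two_pos]
  have := mul_le_mul_of_nonneg_right e1 hZ₁
  have := mul_le_mul_of_nonneg_right e2 hZ₁
  linarith

/-- Banach's fixed point theorem in the bounded continuous functions on the plane, with ratio `Λ ∫
|k| ≤ 1/2`; the bound `2B` comes from `‖w‖ ≤ B + ‖w‖/2`. `N` may depend on the point, so that the
same statement serves both the nonlinear equation and its linearisation. -/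
theorem exists_fixedPoint_duhamel {k : ℝ → ℝ} (hkc : Continuous k) (hk : Integrable k)
    {b : ℝ × ℝ → ℝ} (hb : Continuous b) {B : ℝ} (hB : ∀ q, |b q| ≤ B)
    {N : ℝ × ℝ → ℝ → ℝ} (hN : Continuous fun r : (ℝ × ℝ) × ℝ => N r.1 r.2) {Λ : ℝ} (hΛ : 0 ≤ Λ)
    (hN0 : ∀ q, N q 0 = 0) (hNL : ∀ q s s', |N q s - N q s'| ≤ |k q.1| * (Λ * |s - s'|))
    (hsmall : Λ * ∫ y, |k y| ≤ 1 / 2) :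
    ∃ w : ℝ × ℝ → ℝ, Continuous w ∧ (∀ q, |w q| ≤ 2 * B) ∧
      ∀ q, w q = b q + duhamel (fun r => N r (w r)) q := by
  have cont (w : BoundedContinuousFunction (ℝ × ℝ) ℝ) : Continuous fun r => N r (w r) :=
    hN.comp (continuous_id.prodMk w.continuous)
  have bd (w : BoundedContinuousFunction (ℝ × ℝ) ℝ) (q) :
      |duhamel (fun r => N r (w r)) q| ≤ 1 / 2 * ‖w‖ := by
    have est (r : ℝ × ℝ) : |N r (w r)| ≤ |k r.1| * (Λ * ‖w‖) + 0 := by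
      have h1 := hNL r (w r) 0
      rw [hN0, sub_zero, sub_zero] at h1
      have h2 : |w r| ≤ ‖w‖ := w.norm_coe_le_norm r
      rw [add_zero]
      exact h1.trans (by gcongr)
    have := abs_duhamel_le hkc hk (h := fun r => N r (w r)) (by positivity : 0 ≤ Λ * ‖w‖) le_rfl q
      (fun s _ => est _) (fun s _ => est _)
    nlinarith [mul_le_mul_of_nonneg_right hsmall (norm_nonneg w)]
  let T (w : BoundedContinuousFunction (ℝ × ℝ) ℝ) : BoundedContinuousFunction (ℝ × ℝ) ℝ :=
    BoundedContinuousFunction.ofNormedAddCommGroup (fun q => b q + duhamel (fun r => N r (w r)) q)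
      (hb.add (continuous_duhamel (cont w))) (B + 1 / 2 * ‖w‖)
      (fun q => (abs_add_le _ _).trans (add_le_add (hB q) (bd w q)))
  have hT : ContractingWith (1 / 2) T := by
    refine ⟨by rw [← NNReal.coe_lt_coe]; norm_num, LipschitzWith.of_dist_le_mul fun w w' => ?_⟩
    rw [BoundedContinuousFunction.dist_le (by positivity)]
    intro q
    have est (r : ℝ × ℝ) : |N r (w r) - N r (w' r)| ≤ |k r.1| * (Λ * dist w w') + 0 := by
      have h2 : |w r - w' r| ≤ dist w w' := by
        rw [← Real.dist_eq]; exact BoundedContinuousFunction.dist_coe_le_dist r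
      rw [add_zero]
      exact (hNL r _ _).trans (by gcongr)
    have := abs_duhamel_le hkc hk (h := fun r => N r (w r) - N r (w' r))
      (by positivity : 0 ≤ Λ * dist w w') le_rfl q (fun s _ => est _) (fun s _ => est _)
    rw [duhamel_sub (cont w) (cont w')] at this
    have e : T w q - T w' q = duhamel (fun r => N r (w r)) q - duhamel (fun r => N r (w' r)) q := by
      simp [T]
    rw [Real.dist_eq, e]
    push_cast
    nlinarith [mul_le_mul_of_nonneg_right hsmall (dist_nonneg (x := w) (y := w'))]
  obtain ⟨w, hw⟩ : ∃ w, T w = w := ⟨_, hT.fixedPoint_isFixedPt⟩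
  have hw' (q) : w q = b q + duhamel (fun r => N r (w r)) q := by
    conv_lhs => rw [← hw]
    rfl
  refine ⟨w, w.continuous, ?_, hw'⟩
  have hB0 : 0 ≤ B := (abs_nonneg _).trans (hB 0)
  have : ‖w‖ ≤ B + 1 / 2 * ‖w‖ := by
    refine (BoundedContinuousFunction.norm_le (by positivity)).2 fun q => ?_
    rw [Real.norm_eq_abs]
    conv_lhs => rw [hw' q]
    exact (abs_add_le _ _).trans (add_le_add (hB q) (bd w q))
  exact fun q => (w.norm_coe_le_norm q).trans (by linarith)

/-! ### Free waves, cones and finite speed of propagation. -/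

/-- The `x`-derivative of the free wave with Riemann invariants `A` and `B` at time `0`. -/
noncomputable def freeSlope (A B : ℝ → ℝ) (q : ℝ × ℝ) : ℝ := (A (q.1 + q.2) - B (q.1 - q.2)) / 2

theorem abs_le_of_lipschitz {φ : ℝ → ℝ} {Λ : ℝ} (hφ0 : φ 0 = 0)
    (hL : ∀ s s', |φ s - φ s'| ≤ Λ * |s - s'|) (s : ℝ) : |φ s| ≤ Λ * |s| := by
  simpa [hφ0] using hL s 0

theorem lipschitz_of_abs_deriv_le {φ : ℝ → ℝ} (hφ : ContDiff ℝ 1 φ) {Λ : ℝ}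
    (hΛ : ∀ s, |deriv φ s| ≤ Λ) (s s' : ℝ) : |φ s - φ s'| ≤ Λ * |s - s'| :=
  convex_univ.norm_image_sub_le_of_norm_deriv_le
    (fun x _ => hφ.differentiable one_ne_zero x) (fun x _ => hΛ x) (mem_univ s') (mem_univ s)

/-- From `|t - s| + |s| = |t|`: followed back to time `0`, both characteristics stay in the cone
`|x| + |t| ≤ N` and in the exterior region `|x| - |t| > R`. Both signs of `t` are covered. -/
theorem abs_add_sub_le_of_mem_uIcc {x t s : ℝ} (hs : s ∈ uIcc 0 t) :
    |x + t - s| + |s| ≤ |x| + |t| ∧ |x - t + s| + |s| ≤ |x| + |t| ∧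
    |x| - |t| ≤ |x + t - s| - |s| ∧ |x| - |t| ≤ |x - t + s| - |s| := by
  have key : |t - s| + |s| = |t| := by
    rcases le_total 0 t with h | h
    · rw [uIcc_of_le h] at hs
      rw [abs_of_nonneg (sub_nonneg.2 hs.2), abs_of_nonneg hs.1, abs_of_nonneg h]; ring
    · rw [uIcc_of_ge h] at hs
      rw [abs_of_nonpos (sub_nonpos.2 hs.1), abs_of_nonpos hs.2, abs_of_nonpos h]; ring
  have h1 : |x + t - s| ≤ |x| + |t - s| := by rw [add_sub_assoc]; exact abs_add_le _ _
  have h2 : |x - t + s| ≤ |x| + |t - s| := by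
    rw [show x - t + s = x - (t - s) by ring]; exact abs_sub _ _
  have h3 : |x| ≤ |x + t - s| + |t - s| := by
    simpa [add_sub_assoc] using abs_sub (x + t - s) (t - s)
  have h4 : |x| ≤ |x - t + s| + |t - s| := by
    have := abs_add_le (x - t + s) (t - s)
    rwa [show x - t + s + (t - s) = x by ring] at this
  refine ⟨?_, ?_, ?_, ?_⟩ <;> linarith

theorem isCompact_cone (N : ℝ) : IsCompact {q : ℝ × ℝ | |q.1| + |q.2| ≤ N} := by
  refine Metric.isCompact_of_isClosed_isBounded (isClosed_le (by fun_prop) continuous_const) ?_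
  refine (Metric.isBounded_closedBall (x := (0 : ℝ × ℝ)) (r := N)).subset fun q hq => ?_
  have hq' : |q.1| + |q.2| ≤ N := hq
  rw [mem_closedBall_zero_iff, Prod.norm_def]
  exact max_le (by rw [Real.norm_eq_abs]; linarith [abs_nonneg q.2])
    (by rw [Real.norm_eq_abs]; linarith [abs_nonneg q.1])

theorem exists_modulus_on_cone {w : ℝ × ℝ → ℝ} (hw : Continuous w) (N : ℝ) {η : ℝ} (hη : 0 < η) :
    ∃ δ₀ > 0, ∀ q : ℝ × ℝ, |q.1| + |q.2| ≤ N → ∀ δ, |δ| ≤ δ₀ → |w (q.1 + δ, q.2) - w q| ≤ η := by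
  have hu := (isCompact_cone (N + 1)).uniformContinuousOn_of_continuous hw.continuousOn
  rw [Metric.uniformContinuousOn_iff] at hu
  obtain ⟨d, hd, hd'⟩ := hu η hη
  refine ⟨min (d / 2) 1, by positivity, fun q hq δ hδ => ?_⟩
  have h1 : |δ| ≤ 1 := hδ.trans (min_le_right _ _)
  have h2 : |δ| < d := by linarith [hδ.trans (min_le_left _ _)]
  have := hd' (q.1 + δ, q.2) (by
    have := abs_add_le q.1 δ
    change |q.1 + δ| + |q.2| ≤ N + 1
    linarith) q (hq.trans (by linarith))
    (by simpa [Prod.dist_eq, Real.dist_eq] using h2)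
  rw [Real.dist_eq] at this
  exact this.le

/-- In the exterior region the free slope vanishes, and the region is closed under characteristics.
There the equation therefore bounds `|w|` by half of any earlier bound; iteration forces `w = 0`. -/
theorem eq_zero_of_fixedPoint {k : ℝ → ℝ} (hkc : Continuous k) (hk : Integrable k)
    {φ : ℝ → ℝ} {Λ : ℝ} (hΛ0 : 0 ≤ Λ) (hφ0 : φ 0 = 0)
    (hL : ∀ s s', |φ s - φ s'| ≤ Λ * |s - s'|) (hsmall : Λ * ∫ y, |k y| ≤ 1 / 2)
    {A B : ℝ → ℝ} {R : ℝ} (hA : ∀ y, R < |y| → A y = 0) (hB : ∀ y, R < |y| → B y = 0)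
    {w : ℝ × ℝ → ℝ} {M : ℝ} (hM : ∀ q, |w q| ≤ M)
    (heq : ∀ q, w q = freeSlope A B q + duhamel (fun r => k r.1 * φ (w r)) q)
    (q : ℝ × ℝ) (hq : R < |q.1| - |q.2|) : w q = 0 := by
  have hM0 : 0 ≤ M := (abs_nonneg _).trans (hM 0)
  have step (n : ℕ) : ∀ q : ℝ × ℝ, R < |q.1| - |q.2| → |w q| ≤ M * (1 / 2) ^ n := by
    induction n with
    | zero => intro q _; simpa using hM q
    | succ n ih =>
      intro q hq
      have h0 : freeSlope A B q = 0 := by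
        have h1 := (abs_add_sub_le_of_mem_uIcc (x := q.1) (t := q.2) (s := 0) (by simp)).2.2
        simp only [sub_zero, add_zero, abs_zero] at h1
        simp [freeSlope, hA _ (hq.trans_le h1.1), hB _ (hq.trans_le h1.2)]
      have est (r : ℝ × ℝ) (hr : R < |r.1| - |r.2|) :
          |k r.1 * φ (w r)| ≤ |k r.1| * (Λ * (M * (1 / 2) ^ n)) + 0 := by
        rw [abs_mul, add_zero]
        have := abs_le_of_lipschitz hφ0 hL (w r)
        have := ih r hr
        gcongr
        exact ‹|φ (w r)| ≤ _›.trans (by gcongr)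
      have := abs_duhamel_le hkc hk (h := fun r => k r.1 * φ (w r))
        (by positivity : 0 ≤ Λ * (M * (1 / 2) ^ n)) le_rfl q
        (fun s hs => est _ (hq.trans_le (abs_add_sub_le_of_mem_uIcc hs).2.2.1))
        (fun s hs => est _ (hq.trans_le (abs_add_sub_le_of_mem_uIcc hs).2.2.2))
      rw [heq q, h0, zero_add, pow_succ]
      nlinarith [mul_le_mul_of_nonneg_right hsmall (by positivity : 0 ≤ M * (1 / 2) ^ n)]
  have hlim : Tendsto (fun n : ℕ => M * (1 / 2 : ℝ) ^ n) atTop (𝓝 (M * 0)) :=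
    (tendsto_pow_atTop_nhds_zero_of_lt_one (by norm_num) (by norm_num)).const_mul M
  rw [mul_zero] at hlim
  exact abs_nonpos_iff.1 (ge_of_tendsto' hlim fun n => step n q hq)

/-! ### Differentiability of the fixed point in `x`. -/

theorem abs_freeSlope_quotient_le {A B : ℝ → ℝ} {N η δ : ℝ} (hδ : δ ≠ 0)
    (hA : ∀ y, |y| ≤ N → |A (y + δ) - A y - δ * deriv A y| ≤ η * |δ|)
    (hB : ∀ y, |y| ≤ N → |B (y + δ) - B y - δ * deriv B y| ≤ η * |δ|)
    {q : ℝ × ℝ} (hq : |q.1| + |q.2| ≤ N) :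
    |(freeSlope A B (q.1 + δ, q.2) - freeSlope A B q) / δ - freeSlope (deriv A) (deriv B) q| ≤ η := by
  have e : (freeSlope A B (q.1 + δ, q.2) - freeSlope A B q) / δ - freeSlope (deriv A) (deriv B) q =
      ((A (q.1 + q.2 + δ) - A (q.1 + q.2) - δ * deriv A (q.1 + q.2)) -
        (B (q.1 - q.2 + δ) - B (q.1 - q.2) - δ * deriv B (q.1 - q.2))) / (2 * δ) := by
    simp only [freeSlope]
    rw [show q.1 + δ + q.2 = q.1 + q.2 + δ by ring, show q.1 + δ - q.2 = q.1 - q.2 + δ by ring]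
    field_simp
    ring
  rw [e, abs_div, abs_mul, abs_two, div_le_iff₀ (by positivity)]
  have h1 := hA (q.1 + q.2) ((abs_add_le _ _).trans hq)
  have h2 := hB (q.1 - q.2) ((abs_sub _ _).trans hq)
  have := abs_sub (A (q.1 + q.2 + δ) - A (q.1 + q.2) - δ * deriv A (q.1 + q.2))
    (B (q.1 - q.2 + δ) - B (q.1 - q.2) - δ * deriv B (q.1 - q.2))
  linarith

/-- The fixed point `w` of the integral equation has a continuous partial derivative in `x`. -/
theorem exists_hasDerivAt_fixedPoint {k : ℝ → ℝ} (hkC : ContDiff ℝ 1 k) (hk : Integrable k)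
    (hk' : Integrable (deriv k)) {φ : ℝ → ℝ} (hφ : ContDiff ℝ 1 φ) {Λ : ℝ} (hφ0 : φ 0 = 0)
    (hΛ : ∀ s, |deriv φ s| ≤ Λ) (hsmall : Λ * ∫ y, |k y| ≤ 1 / 2)
    {A B : ℝ → ℝ} (hA : ContDiff ℝ 1 A) (hB : ContDiff ℝ 1 B) {D : ℝ}
    (hA' : ∀ y, |deriv A y| ≤ D) (hB' : ∀ y, |deriv B y| ≤ D)
    {w : ℝ × ℝ → ℝ} (hw : Continuous w) {M : ℝ} (hM : ∀ q, |w q| ≤ M)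
    (heq : ∀ q, w q = freeSlope A B q + duhamel (fun r => k r.1 * φ (w r)) q) :
    ∃ z : ℝ × ℝ → ℝ, Continuous z ∧ ∀ x t, HasDerivAt (fun y => w (y, t)) (z (x, t)) x := by
  have hL := lipschitz_of_abs_deriv_le hφ hΛ
  have hΛ0 : 0 ≤ Λ := (abs_nonneg _).trans (hΛ 0)
  have hM0 : 0 ≤ M := (abs_nonneg _).trans (hM 0)
  have hkc := hkC.continuous
  have hk'c : Continuous (deriv k) := hkC.continuous_deriv le_rfl
  have hφc := hφ.continuous
  have hφ'c : Continuous (deriv φ) := hφ.continuous_deriv le_rfl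
  have hA'c : Continuous (deriv A) := hA.continuous_deriv le_rfl
  have hB'c : Continuous (deriv B) := hB.continuous_deriv le_rfl
  have hφM (q) : |φ (w q)| ≤ Λ * M :=
    (abs_le_of_lipschitz hφ0 hL _).trans (by gcongr; exact hM q)
  have hc₁ : Continuous fun r : ℝ × ℝ => deriv k r.1 * φ (w r) := by fun_prop
  -- The candidate `z` solves the formally differentiated equation. The term `k' φ(w)` is already
  -- known and joins the inhomogeneity; what acts on `z` has the same Lipschitz constant `Λ`.
  obtain ⟨z, hz, hzb, hzeq⟩ := exists_fixedPoint_duhamel hkc hk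
    (b := fun q => freeSlope (deriv A) (deriv B) q + duhamel (fun r => deriv k r.1 * φ (w r)) q)
    (by
      refine Continuous.add ?_ (continuous_duhamel hc₁)
      unfold freeSlope; fun_prop)
    (B := D + (∫ y, |deriv k y|) * (Λ * M))
    (fun q => by
      have est (r : ℝ × ℝ) : |deriv k r.1 * φ (w r)| ≤ |deriv k r.1| * (Λ * M) + 0 := by
        rw [abs_mul, add_zero]; gcongr; exact hφM r
      have h1 := abs_duhamel_le hk'c hk' (h := fun r => deriv k r.1 * φ (w r))
        (by positivity : 0 ≤ Λ * M) le_rfl q (fun s _ => est _) (fun s _ => est _)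
      have h2 : |freeSlope (deriv A) (deriv B) q| ≤ D := by
        unfold freeSlope
        rw [abs_div, abs_two, div_le_iff₀ two_pos]
        linarith [abs_sub (deriv A (q.1 + q.2)) (deriv B (q.1 - q.2)), hA' (q.1 + q.2), hB' (q.1 - q.2)]
      linarith [abs_add_le (freeSlope (deriv A) (deriv B) q)
        (duhamel (fun r => deriv k r.1 * φ (w r)) q)])
    (N := fun q s => k q.1 * (deriv φ (w q) * s)) (by fun_prop) hΛ0 (by simp)
    (fun q s s' => by
      rw [← mul_sub, ← mul_sub, abs_mul, abs_mul]
      gcongr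
      exact hΛ _) hsmall
  refine ⟨z, hz, ?_⟩
  set Z := 2 * (D + (∫ y, |deriv k y|) * (Λ * M)) with hZ
  have hZ0 : 0 ≤ Z := (abs_nonneg _).trans (hzb 0)
  set I := ∫ y, |k y| with hI
  have hI0 : 0 ≤ I := integral_nonneg fun _ => abs_nonneg _
  have hc : Continuous fun r : ℝ × ℝ => k r.1 * φ (w r) := by fun_prop
  have hc₂ : Continuous fun r : ℝ × ℝ => k r.1 * (deriv φ (w r) * z r) := by fun_prop
  -- the equation satisfied by the error of the difference quotients
  have herr (δ : ℝ) (q : ℝ × ℝ) : (w (q.1 + δ, q.2) - w q) / δ - z q =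
      ((freeSlope A B (q.1 + δ, q.2) - freeSlope A B q) / δ - freeSlope (deriv A) (deriv B) q) +
      duhamel (fun r => δ⁻¹ * (k (r.1 + δ) * φ (w (r.1 + δ, r.2)) - k r.1 * φ (w r)) -
        (k r.1 * (deriv φ (w r) * z r) + deriv k r.1 * φ (w r))) q := by
    have e1 := duhamel_sub (h₁ := fun r : ℝ × ℝ => δ⁻¹ * (k (r.1 + δ) * φ (w (r.1 + δ, r.2)) - k r.1 * φ (w r)))
      (h₂ := fun r : ℝ × ℝ => (k r.1 * (deriv φ (w r) * z r) + deriv k r.1 * φ (w r)))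
      (by fun_prop) (by fun_prop) q
    have e2 := duhamel_const_mul δ⁻¹ (fun r : ℝ × ℝ => k (r.1 + δ) * φ (w (r.1 + δ, r.2)) - k r.1 * φ (w r)) q
    have e3 := duhamel_sub (h₁ := fun r : ℝ × ℝ => k (r.1 + δ) * φ (w (r.1 + δ, r.2)))
      (h₂ := fun r : ℝ × ℝ => k r.1 * φ (w r)) (by fun_prop) hc q
    have e4 := duhamel_translate (fun r => k r.1 * φ (w r)) δ q
    have e5 := duhamel_add hc₂ hc₁ q
    simp only at e1 e2 e3 e4 e5
    rw [e1, e2, e3, e4, e5, heq q, heq (q.1 + δ, q.2), hzeq q]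
    ring
  have main (N : ℝ) (hN : 0 ≤ N) {ε : ℝ} (hε : 0 < ε) : ∃ δ₀ > 0, ∀ δ, δ ≠ 0 → |δ| ≤ δ₀ →
      ∀ q : ℝ × ℝ, |q.1| + |q.2| ≤ N → |(w (q.1 + δ, q.2) - w q) / δ - z q| ≤ ε := by
    obtain ⟨K, hK⟩ := (isCompact_closedBall (0 : ℝ) N).exists_bound_of_continuousOn hk'c.continuousOn
    have hK0 : 0 ≤ K := (norm_nonneg _).trans (hK 0 (by simpa using hN))
    -- `H` collects the coefficients of `η` in the final inequality `S ≤ η H + (I η) S + (Λ I) S`.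
    -- With `I η ≤ 1/4` and `Λ I ≤ 1/2` this leaves `S ≤ 4 η H ≤ ε`.
    set H := 1 + I * Z + N * (Λ * M + K * Λ) with hH
    have hH1 : 1 ≤ H := by
      have : 0 ≤ I * Z + N * (Λ * M + K * Λ) := by positivity
      linarith
    obtain ⟨η, hη, hη1, hη2⟩ : ∃ η > 0, I * η ≤ 1 / 4 ∧ η * H ≤ ε / 4 := by
      refine ⟨min (1 / (4 * (I + 1))) (ε / (4 * H)), by positivity, ?_, ?_⟩
      · have h1 : I * min (1 / (4 * (I + 1))) (ε / (4 * H)) ≤ I * (1 / (4 * (I + 1))) := by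
          gcongr; exact min_le_left _ _
        refine h1.trans ?_
        rw [mul_one_div, div_le_div_iff₀ (by positivity) (by positivity)]
        linarith
      · have h1 : min (1 / (4 * (I + 1))) (ε / (4 * H)) * H ≤ ε / (4 * H) * H := by
          gcongr; exact min_le_right _ _
        refine h1.trans (le_of_eq ?_)
        field_simp
    obtain ⟨d₁, hd₁, HA⟩ := exists_taylor_bound hA N hη
    obtain ⟨d₂, hd₂, HB⟩ := exists_taylor_bound hB N hη
    obtain ⟨d₃, hd₃, Hk⟩ := exists_taylor_bound hkC N hη
    obtain ⟨d₄, hd₄, Hφ⟩ := exists_taylor_bound hφ M hη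
    obtain ⟨d₅, hd₅, Hw⟩ := exists_modulus_on_cone hw N hd₄
    obtain ⟨d₆, hd₆, Hw'⟩ := exists_modulus_on_cone hw N hη
    refine ⟨min (min d₁ d₂) (min d₃ (min d₅ d₆)), by positivity, fun δ hδ hδ' => ?_⟩
    simp only [le_min_iff] at hδ'
    obtain ⟨⟨hδ1, hδ2⟩, hδ3, hδ5, hδ6⟩ := hδ'
    -- The error is maximised over a compact cone closed under characteristics, so its maximum `S`
    -- bounds the error wherever the integral equation at `q₀` looks.
    obtain ⟨q₀, hq₀, hmax⟩ := (isCompact_cone N).exists_isMaxOn ⟨0, by simpa using hN⟩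
      (f := fun q : ℝ × ℝ => |(w (q.1 + δ, q.2) - w q) / δ - z q|) (by fun_prop)
    set S := |(w (q₀.1 + δ, q₀.2) - w q₀) / δ - z q₀| with hS
    have hS0 : 0 ≤ S := abs_nonneg _
    have hSb (q : ℝ × ℝ) (hq : |q.1| + |q.2| ≤ N) : |(w (q.1 + δ, q.2) - w q) / δ - z q| ≤ S := hmax hq
    have est (r : ℝ × ℝ) (hr : |r.1| + |r.2| ≤ N) :
        |δ⁻¹ * (k (r.1 + δ) * φ (w (r.1 + δ, r.2)) - k r.1 * φ (w r)) -
          (k r.1 * (deriv φ (w r) * z r) + deriv k r.1 * φ (w r))| ≤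
        |k r.1| * (η * (S + Z) + Λ * S) + (η * (Λ * M) + K * (Λ * η)) := by
      have hrN : |r.1| ≤ N := by linarith [abs_nonneg r.2]
      have hS1 := hSb r hr
      have i1 := Hk r.1 δ hrN hδ3
      have i2 := Hφ (w r) (w (r.1 + δ, r.2) - w r) (hM r) (Hw r hr δ hδ5)
      have i3 := Hw' r hr δ hδ6
      have i4 : |deriv k r.1| ≤ K := hK r.1 (by simpa using hrN)
      have i5 := hφM (r.1 + δ, r.2)
      have i6 := hL (w (r.1 + δ, r.2)) (w r)
      rw [add_sub_cancel] at i2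
      generalize w (r.1 + δ, r.2) = b at *
      generalize w r = a at *
      have hab : b - a = δ * (((b - a) / δ - z r) + z r) := by field_simp; ring
      have hab' : |b - a| ≤ |δ| * (S + Z) := by
        rw [hab, abs_mul]
        gcongr
        exact (abs_add_le _ _).trans (add_le_add hS1 (hzb r))
      have e : δ⁻¹ * (k (r.1 + δ) * φ b - k r.1 * φ a) -
          (k r.1 * (deriv φ a * z r) + deriv k r.1 * φ a) =
          k r.1 * ((φ b - φ a - (b - a) * deriv φ a) / δ + deriv φ a * ((b - a) / δ - z r)) +
          ((k (r.1 + δ) - k r.1 - δ * deriv k r.1) / δ * φ b + deriv k r.1 * (φ b - φ a)) := by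
        field_simp
        ring
      rw [e]
      have j1 : |(φ b - φ a - (b - a) * deriv φ a) / δ| ≤ η * (S + Z) := by
        rw [abs_div, div_le_iff₀ (abs_pos.2 hδ)]
        calc _ ≤ η * |b - a| := i2
          _ ≤ η * (|δ| * (S + Z)) := by gcongr
          _ = _ := by ring
      have j2 : |deriv φ a * ((b - a) / δ - z r)| ≤ Λ * S := by
        rw [abs_mul]; exact mul_le_mul (hΛ _) hS1 (abs_nonneg _) hΛ0
      have j3 : |(k (r.1 + δ) - k r.1 - δ * deriv k r.1) / δ * φ b| ≤ η * (Λ * M) := by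
        rw [abs_mul]
        refine mul_le_mul ?_ i5 (abs_nonneg _) hη.le
        rw [abs_div, div_le_iff₀ (abs_pos.2 hδ)]
        exact i1
      have j4 : |deriv k r.1 * (φ b - φ a)| ≤ K * (Λ * η) := by
        rw [abs_mul]
        exact mul_le_mul i4 (i6.trans (by gcongr)) (abs_nonneg _) hK0
      refine (abs_add_le _ _).trans (add_le_add ?_ ((abs_add_le _ _).trans (add_le_add j3 j4)))
      rw [abs_mul]
      gcongr
      exact (abs_add_le _ _).trans (add_le_add j1 j2)
    have hb := abs_duhamel_le hkc hk
      (h := fun r => δ⁻¹ * (k (r.1 + δ) * φ (w (r.1 + δ, r.2)) - k r.1 * φ (w r)) -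
          (k r.1 * (deriv φ (w r) * z r) + deriv k r.1 * φ (w r)))
      (by positivity : 0 ≤ η * (S + Z) + Λ * S)
      (by positivity : 0 ≤ η * (Λ * M) + K * (Λ * η)) q₀
      (fun s hs => est _ ((abs_add_sub_le_of_mem_uIcc hs).1.trans hq₀))
      (fun s hs => est _ ((abs_add_sub_le_of_mem_uIcc hs).2.1.trans hq₀))
    have hfree := abs_freeSlope_quotient_le hδ (fun y hy => HA y δ hy hδ1)
      (fun y hy => HB y δ hy hδ2) hq₀
    have hS2 : S ≤ η + (I * (η * (S + Z) + Λ * S) + N * (η * (Λ * M) + K * (Λ * η))) := by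
      refine (hS.trans (congrArg abs (herr δ q₀))).trans_le ?_
      refine (abs_add_le _ _).trans (add_le_add hfree (hb.trans ?_))
      have hq₀' : |q₀.1| + |q₀.2| ≤ N := hq₀
      gcongr
      linarith [abs_nonneg q₀.1]
    have hSε : S ≤ ε := by
      have e : η + (I * (η * (S + Z) + Λ * S) + N * (η * (Λ * M) + K * (Λ * η))) =
          η * H + (I * η) * S + (Λ * I) * S := by rw [hH]; ring
      have := mul_le_mul_of_nonneg_right hη1 hS0
      have := mul_le_mul_of_nonneg_right hsmall hS0
      linarith
    exact fun q hq => (hSb q hq).trans hSε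
  intro x t
  rw [hasDerivAt_iff_tendsto_slope_zero, Metric.tendsto_nhds]
  intro ε hε
  obtain ⟨δ₀, hδ₀, hδ⟩ := main (|x| + |t|) (by positivity) (half_pos hε)
  have : ∀ᶠ δ in 𝓝[≠] (0 : ℝ), δ ≠ 0 ∧ |δ| ≤ δ₀ := by
    refine (eventually_mem_nhdsWithin).and (eventually_nhdsWithin_of_eventually_nhds ?_)
    filter_upwards [Metric.closedBall_mem_nhds (0 : ℝ) hδ₀] with δ h
    simpa using h
  filter_upwards [this] with δ h
  have := hδ δ h.1 h.2 (x, t) le_rfl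
  rw [Real.dist_eq, smul_eq_mul, ← div_eq_inv_mul]
  linarith

/-! ### Transport equations and the C² solution of the semilinear problem. -/

theorem exists_partials_integral_param {g gx : ℝ × ℝ → ℝ} (cg : Continuous g) (cgx : Continuous gx)
    (hg : ∀ x s, HasDerivAt (fun y => g (y, s)) (gx (x, s)) x) :
    ∃ P Px : ℝ × ℝ → ℝ, (∀ q, P q = ∫ s in (0 : ℝ)..q.2, g (q.1, s)) ∧ Continuous Px ∧
      ∀ q, HasStrictFDerivAt P ((ContinuousLinearMap.toSpanSingleton ℝ (Px q)).coprod
        (ContinuousLinearMap.toSpanSingleton ℝ (g q))) q :=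
  ⟨fun q => ∫ s in (0 : ℝ)..q.2, g (q.1, s), fun q => ∫ s in (0 : ℝ)..q.2, gx (q.1, s),
    fun _ => rfl, continuous_integral_param cgx, hasStrictFDerivAt_of_partials
      (fun x t => hasDerivAt_integral_param cg cgx hg x 0 t)
      (fun x t => hasDerivAt_integral_end cg x t) (continuous_integral_param cgx) cg⟩

/-- The value at `(x, t)` of the Riemann invariant that solves `∂ₜ a - c ∂ₓ a = h`, `c = ±1`,
with initial value `A`, together with its partial derivatives. -/
theorem exists_transport_solution {A : ℝ → ℝ} (hA : ContDiff ℝ 1 A) {h hx : ℝ × ℝ → ℝ}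
    (ch : Continuous h) (chx : Continuous hx)
    (hh : ∀ x s, HasDerivAt (fun y => h (y, s)) (hx (x, s)) x) (c : ℝ) :
    ∃ a ax : ℝ × ℝ → ℝ, (∀ x t, a (x, t) = A (x + c * t) + ∫ s in (0 : ℝ)..t, h (x + c * (t - s), s)) ∧
      Continuous ax ∧ (∀ x t, HasDerivAt (fun y => a (y, t)) (ax (x, t)) x) ∧
      ∀ x t, HasDerivAt (fun s => a (x, s)) (c * ax (x, t) + h (x, t)) t := by
  -- In the coordinate `y = x + c t`, constant along a characteristic, the integrand no longer
  -- involves `t`, which enters only as the endpoint.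
  obtain ⟨P, Px, hP, cPx, hPd⟩ := exists_partials_integral_param
    (g := fun r => h (r.1 - c * r.2, r.2)) (gx := fun r => hx (r.1 - c * r.2, r.2))
    (by fun_prop) (by fun_prop) (fun x s => by
      simpa using (hh (x - c * s) s).comp_sub_const x (c * s))
  have hA' (y) : HasDerivAt A (deriv A y) y := (hA.differentiable one_ne_zero y).hasDerivAt
  have cA' : Continuous (deriv A) := hA.continuous_deriv le_rfl
  refine ⟨fun q => A (q.1 + c * q.2) + P (q.1 + c * q.2, q.2),
    fun q => deriv A (q.1 + c * q.2) + Px (q.1 + c * q.2, q.2), fun x t => ?_, by fun_prop,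
    fun x t => ?_, fun x t => ?_⟩
  · simp only [hP]
    congr 2
    ext s
    ring_nf
  · have d1 : HasDerivAt (fun y : ℝ => y + c * t) 1 x := (hasDerivAt_id x).add_const _
    have d2 : HasDerivAt (fun y : ℝ => (y + c * t, t)) ((1 : ℝ), (0 : ℝ)) x :=
      d1.prodMk (hasDerivAt_const x t)
    have d3 := (hPd (x + c * t, t)).hasFDerivAt.comp_hasDerivAt x d2
    have d4 := (hA' (x + c * t)).comp x d1
    simpa [Function.comp_def] using d4.fun_add d3
  · have d1 : HasDerivAt (fun s : ℝ => x + c * s) c t := by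
      simpa using ((hasDerivAt_id t).const_mul c).const_add x
    have d2 : HasDerivAt (fun s : ℝ => (x + c * s, s)) (c, (1 : ℝ)) t :=
      d1.prodMk (hasDerivAt_id t)
    have d3 := HasFDerivAt.comp_hasDerivAt (f := fun s => (x + c * s, s)) t
      (hPd (x + c * t, t)).hasFDerivAt d2
    have d4 := (hA' (x + c * t)).comp t d1
    have d5 := d4.fun_add d3
    simp only [Function.comp_def, ContinuousLinearMap.coprod_apply, add_sub_cancel_right,
      ContinuousLinearMap.toSpanSingleton_apply, smul_eq_mul, one_mul] at d5
    exact d5.congr_deriv (by ring)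

/-- The solution is built on the whole plane, both time directions included, so no boundary
regularity arises. With `A = G + F'` and `B = G - F'` as initial Riemann invariants, the slope
equation gives `w`, transport gives `a` and `b`, and `w = (a - b)/2`, `v = (a + b)/2` are the future
`u_x` and `u_t`. -/
theorem exists_semilinear_wave {k : ℝ → ℝ} (hkC : ContDiff ℝ 1 k) (hk : Integrable k)
    (hk' : Integrable (deriv k)) {φ : ℝ → ℝ} (hφ : ContDiff ℝ 1 φ) {Λ : ℝ} (hφ0 : φ 0 = 0)
    (hΛ : ∀ s, |deriv φ s| ≤ Λ) (hsmall : Λ * ∫ y, |k y| ≤ 1 / 2)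
    {F G : ℝ → ℝ} (hF : ContDiff ℝ 2 F) (hG : ContDiff ℝ 1 G) {R : ℝ}
    (hFR : ∀ x, R < |x| → F x = 0) (hGR : ∀ x, R < |x| → G x = 0) {m : ℝ}
    (hFm : ∀ x, |deriv F x| ≤ m / 2) (hGm : ∀ x, |G x| ≤ m / 2) :
    ∃ u : ℝ → ℝ → ℝ, ContDiff ℝ 2 (fun q : ℝ × ℝ => u q.1 q.2) ∧
      (∀ x t, iteratedDeriv 2 (fun s => u x s) t - iteratedDeriv 2 (fun y => u y t) x =
        k x * φ (deriv (fun y => u y t) x)) ∧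
      (∀ x, u x 0 = F x) ∧ (∀ x, HasDerivAt (fun s => u x s) (G x) 0) ∧
      (∀ x t, |deriv (fun y => u y t) x| ≤ 2 * m) ∧
      ∀ x t, R < |x| - |t| → deriv (fun y => u y t) x = 0 := by
  have hF'C : ContDiff ℝ 1 (deriv F) := by
    have : ContDiff ℝ (1 + 1) F := by simpa [one_add_one_eq_two] using hF
    exact (contDiff_succ_iff_deriv.1 this).2.2
  have hFd (x) : HasDerivAt F (deriv F x) x := (hF.differentiable two_ne_zero x).hasDerivAt
  have hF'R (x) (hx : R < |x|) : deriv F x = 0 := by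
    have : F =ᶠ[𝓝 x] fun _ => 0 := by
      filter_upwards [(isOpen_lt continuous_const continuous_abs).mem_nhds hx] with y hy
      exact hFR y hy
    rw [this.deriv_eq, deriv_const]
  have hL := lipschitz_of_abs_deriv_le hφ hΛ
  have hΛ0 : 0 ≤ Λ := (abs_nonneg _).trans (hΛ 0)
  have hkc := hkC.continuous
  have hφc := hφ.continuous
  have hφ'c : Continuous (deriv φ) := hφ.continuous_deriv le_rfl
  have hk'c : Continuous (deriv k) := hkC.continuous_deriv le_rfl
  obtain ⟨A, hA, hAe⟩ : ∃ A : ℝ → ℝ, ContDiff ℝ 1 A ∧ ∀ x, A x = G x + deriv F x :=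
    ⟨_, hG.add hF'C, fun _ => rfl⟩
  obtain ⟨B, hB, hBe⟩ : ∃ B : ℝ → ℝ, ContDiff ℝ 1 B ∧ ∀ x, B x = G x - deriv F x :=
    ⟨_, hG.sub hF'C, fun _ => rfl⟩
  have hAR (x) (hx : R < |x|) : A x = 0 := by rw [hAe, hGR x hx, hF'R x hx, add_zero]
  have hBR (x) (hx : R < |x|) : B x = 0 := by rw [hBe, hGR x hx, hF'R x hx, sub_zero]
  have bound_deriv {E : ℝ → ℝ} (hE : ContDiff ℝ 1 E) (hER : ∀ x, R < |x| → E x = 0) :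
      ∃ D, ∀ y, |deriv E y| ≤ D := by
    refine (HasCompactSupport.deriv (HasCompactSupport.intro (isCompact_closedBall (0 : ℝ) R)
      fun x hx => hER x ?_)).exists_bound_of_continuous (hE.continuous_deriv le_rfl)
    simpa using hx
  obtain ⟨D₁, hD₁⟩ := bound_deriv hA hAR
  obtain ⟨D₂, hD₂⟩ := bound_deriv hB hBR
  obtain ⟨w, cw, hwb, hweq⟩ := exists_fixedPoint_duhamel hkc hk (b := freeSlope A B)
    (by have := hA.continuous; have := hB.continuous; unfold freeSlope; fun_prop)
    (B := m) (fun q => by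
      unfold freeSlope
      rw [abs_div, abs_two, div_le_iff₀ two_pos]
      have h1 := abs_add_le (G (q.1 + q.2)) (deriv F (q.1 + q.2))
      have h2 := abs_sub (G (q.1 - q.2)) (deriv F (q.1 - q.2))
      have h3 := abs_sub (A (q.1 + q.2)) (B (q.1 - q.2))
      rw [← hAe] at h1
      rw [← hBe] at h2
      linarith [hFm (q.1 + q.2), hFm (q.1 - q.2), hGm (q.1 + q.2), hGm (q.1 - q.2)])
    (N := fun q s => k q.1 * φ s) (by fun_prop) hΛ0 (by simp [hφ0])
    (fun q s s' => by rw [← mul_sub, abs_mul]; gcongr; exact hL _ _) hsmall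
  have hwR := eq_zero_of_fixedPoint hkc hk hΛ0 hφ0 hL hsmall hAR hBR hwb hweq
  obtain ⟨z, cz, hz⟩ := exists_hasDerivAt_fixedPoint hkC hk hk' hφ hφ0 hΛ hsmall hA hB
    (D := max D₁ D₂) (fun y => (hD₁ y).trans (le_max_left _ _))
    (fun y => (hD₂ y).trans (le_max_right _ _)) cw hwb hweq
  have hhx (x t : ℝ) : HasDerivAt (fun y => k y * φ (w (y, t)))
      (deriv k x * φ (w (x, t)) + k x * (deriv φ (w (x, t)) * z (x, t))) x :=
    ((hkC.differentiable one_ne_zero x).hasDerivAt).fun_mul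
      (((hφ.differentiable one_ne_zero _).hasDerivAt).comp x (hz x t))
  obtain ⟨a, ax, ha, cax, hax, hat⟩ := exists_transport_solution hA
    (h := fun q => k q.1 * φ (w q))
    (hx := fun q => deriv k q.1 * φ (w q) + k q.1 * (deriv φ (w q) * z q))
    (by fun_prop) (by fun_prop) hhx 1
  obtain ⟨b, bx, hb, cbx, hbx, hbt⟩ := exists_transport_solution hB
    (h := fun q => k q.1 * φ (w q))
    (hx := fun q => deriv k q.1 * φ (w q) + k q.1 * (deriv φ (w q) * z q))
    (by fun_prop) (by fun_prop) hhx (-1)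
  have hw (x t) : w (x, t) = (a (x, t) - b (x, t)) / 2 := by
    rw [hweq, ha, hb]
    simp only [freeSlope, duhamel]
    rw [intervalIntegral.integral_sub (Continuous.intervalIntegrable (by fun_prop) _ _)
      (Continuous.intervalIntegrable (by fun_prop) _ _)]
    rw [show x + 1 * t = x + t by ring, show x + -1 * t = x - t by ring]
    have e1 : (fun s => k (x + 1 * (t - s)) * φ (w (x + 1 * (t - s), s))) =
        fun s => k (x + t - s) * φ (w (x + t - s, s)) := by ext s; ring_nf
    have e2 : (fun s => k (x + -1 * (t - s)) * φ (w (x + -1 * (t - s), s))) =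
        fun s => k (x - t + s) * φ (w (x - t + s, s)) := by ext s; ring_nf
    rw [e1, e2]
    ring
  have hwx (x t : ℝ) : HasDerivAt (fun y => w (y, t)) ((ax (x, t) - bx (x, t)) / 2) x := by
    simp_rw [hw]
    exact ((hax x t).fun_sub (hbx x t)).div_const 2
  have hwt (x t : ℝ) : HasDerivAt (fun s => w (x, s)) ((ax (x, t) + bx (x, t)) / 2) t := by
    simp_rw [hw]
    refine (((hat x t).fun_sub (hbt x t)).div_const 2).congr_deriv ?_
    ring
  obtain ⟨v, hv⟩ : ∃ v : ℝ × ℝ → ℝ, ∀ q, v q = (a q + b q) / 2 := ⟨_, fun _ => rfl⟩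
  have hvx (x t : ℝ) : HasDerivAt (fun y => v (y, t)) ((ax (x, t) + bx (x, t)) / 2) x := by
    simp_rw [hv]
    exact ((hax x t).fun_add (hbx x t)).div_const 2
  have hvt (x t : ℝ) : HasDerivAt (fun s => v (x, s))
      ((ax (x, t) - bx (x, t)) / 2 + k x * φ (w (x, t))) t := by
    simp_rw [hv]
    refine (((hat x t).fun_add (hbt x t)).div_const 2).congr_deriv ?_
    ring
  have hwC : ContDiff ℝ 1 w := contDiff_one_of_partials
    (Fx := fun q => (ax q - bx q) / 2) (Ft := fun q => (ax q + bx q) / 2)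
    hwx hwt (by fun_prop) (by fun_prop)
  have hvC : ContDiff ℝ 1 v := contDiff_one_of_partials
    (Fx := fun q => (ax q + bx q) / 2) (Ft := fun q => (ax q - bx q) / 2 + k q.1 * φ (w q))
    hvx hvt (by fun_prop) (by fun_prop)
  -- Integrating `v` in time gives `u_t = v`. The compatibility `v_x = w_t` then gives `u_x = F' + ∫
  -- w_t = w`.
  obtain ⟨u, hu⟩ : ∃ u : ℝ → ℝ → ℝ, ∀ x t, u x t = F x + ∫ s in (0 : ℝ)..t, v (x, s) :=
    ⟨_, fun _ _ => rfl⟩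
  have hut (x t : ℝ) : HasDerivAt (fun s => u x s) (v (x, t)) t := by
    simp_rw [hu]
    exact (hasDerivAt_integral_end hvC.continuous x t).const_add _
  have hw0 (x : ℝ) : w (x, 0) = deriv F x := by
    rw [hw, ha, hb]
    simp only [mul_zero, add_zero, intervalIntegral.integral_same, hAe, hBe]
    ring
  have hux (x t : ℝ) : HasDerivAt (fun y => u y t) (w (x, t)) x := by
    simp_rw [hu]
    refine ((hFd x).fun_add (hasDerivAt_integral_param hvC.continuous
      (gx := fun q => (ax q + bx q) / 2) (by fun_prop) hvx x 0 t)).congr_deriv ?_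
    rw [intervalIntegral.integral_eq_sub_of_hasDerivAt (fun s _ => hwt x s)
      (Continuous.intervalIntegrable (by fun_prop) _ _), hw0]
    ring
  have hux' (x t : ℝ) : deriv (fun y => u y t) x = w (x, t) := (hux x t).deriv
  refine ⟨u, contDiff_two_of_partials (F := fun q : ℝ × ℝ => u q.1 q.2) hux hut hwC hvC,
    fun x t => ?_, fun x => by simp [hu], fun x => ?_, fun x t => ?_, fun x t h => ?_⟩
  · rw [hux', iteratedDeriv_succ, iteratedDeriv_one, iteratedDeriv_succ, iteratedDeriv_one]
    have e1 : deriv (fun s => u x s) = fun s => v (x, s) := funext fun s => (hut x s).deriv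
    have e2 : deriv (fun y => u y t) = fun y => w (y, t) := funext fun y => hux' y t
    rw [e1, e2, (hvt x t).deriv, (hwx x t).deriv]
    ring
  · refine (hut x 0).congr_deriv ?_
    rw [hv, ha, hb]
    simp only [mul_zero, add_zero, intervalIntegral.integral_same, hAe, hBe]
    ring
  · rw [hux']; exact hwb _
  · rw [hux']; exact hwR _ h

/-! ### Uniqueness: Riemann invariants of an arbitrary classical solution. -/

theorem iteratedDeriv_two_comp_line {d : ℝ × ℝ → ℝ} {c : ℝ → ℝ × ℝ} {e : ℝ × ℝ}
    (hc : ∀ s, HasDerivAt c e s) {t : ℝ} (h : ContDiffAt ℝ 2 d (c t)) :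
    iteratedDeriv 2 (fun s => d (c s)) t = fderiv ℝ (fderiv ℝ d) (c t) e e := by
  have hcc : Continuous c := continuous_iff_continuousAt.2 fun s => (hc s).continuousAt
  have h1 : ∀ᶠ s in 𝓝 t, deriv (fun s => d (c s)) s = fderiv ℝ d (c s) e := by
    filter_upwards [hcc.continuousAt.eventually (h.eventually (by simp))] with s hs
    exact ((hs.differentiableAt two_ne_zero).hasFDerivAt.comp_hasDerivAt s (hc s)).deriv
  have h2 : HasFDerivAt (fderiv ℝ d) (fderiv ℝ (fderiv ℝ d) (c t)) (c t) :=
    ((h.fderiv_right (m := 1) (by norm_num)).differentiableAt one_ne_zero).hasFDerivAt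
  rw [iteratedDeriv_succ, iteratedDeriv_one, EventuallyEq.deriv_eq h1]
  exact ((h2.comp_hasDerivAt t (hc t)).clm_apply (hasDerivAt_const t e)).deriv.trans (by simp)

theorem hasDerivAt_slice {U : ℝ × ℝ → ℝ} {x t : ℝ} (hC : ContDiffAt ℝ 2 U (x, t)) :
    HasDerivAt (fun y => U (y, t)) (fderiv ℝ U (x, t) (1, 0)) x :=
  (hC.differentiableAt two_ne_zero).hasFDerivAt.comp_hasDerivAt x
    ((hasDerivAt_id x).prodMk (hasDerivAt_const x t))

/-- Along the characteristics of slope `-σ = ±1`, the Riemann invariant `∂ₜ U + σ ∂ₓ U` has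
derivative `∂ₜ² U - ∂ₓ² U`. -/
theorem hasDerivAt_fderiv_characteristic {U : ℝ × ℝ → ℝ} {L : ℝ × ℝ → ℝ × ℝ →L[ℝ] ℝ} {x t : ℝ}
    (hC : ContDiffAt ℝ 2 U (x, t)) (hL : L =ᶠ[𝓝 (x, t)] fderiv ℝ U) {σ : ℝ} (hσ : σ ^ 2 = 1) :
    HasDerivAt (fun s => L (x + σ * (t - s), s) (σ, 1))
      (iteratedDeriv 2 (fun s => U (x, s)) t - iteratedDeriv 2 (fun y => U (y, t)) x) t := by
  have h2 : HasFDerivAt L (fderiv ℝ (fderiv ℝ U) (x, t)) (x, t) :=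
    ((hC.fderiv_right (m := 1) (by norm_num)).differentiableAt one_ne_zero).hasFDerivAt.congr_of_eventuallyEq hL
  have hc₁ : HasDerivAt (fun s : ℝ => x + σ * (t - s)) (-σ) t := by
    simpa using (((hasDerivAt_id t).const_sub t).const_mul σ).const_add x
  have hc : HasDerivAt (fun s : ℝ => (x + σ * (t - s), s)) (-σ, (1 : ℝ)) t :=
    hc₁.prodMk (hasDerivAt_id t)
  have hct : (x + σ * (t - t), t) = (x, t) := by simp
  rw [← hct] at h2
  have h3 : HasDerivAt (fun s : ℝ => L (x + σ * (t - s), s))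
      (fderiv ℝ (fderiv ℝ U) (x + σ * (t - t), t) (-σ, 1)) t :=
    HasFDerivAt.comp_hasDerivAt (f := fun s : ℝ => (x + σ * (t - s), s)) t h2 hc
  rw [hct] at h3
  have h4 := h3.clm_apply (hasDerivAt_const t (σ, (1 : ℝ)))
  refine h4.congr_deriv ?_
  have hx := iteratedDeriv_two_comp_line (d := U) (c := fun y => (y, t)) (e := ((1 : ℝ), (0 : ℝ)))
    (fun s => (hasDerivAt_id s).prodMk (hasDerivAt_const s t)) (t := x) hC
  have ht := iteratedDeriv_two_comp_line (d := U) (c := fun s => (x, s)) (e := ((0 : ℝ), (1 : ℝ)))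
    (fun s => (hasDerivAt_const s x).prodMk (hasDerivAt_id s)) (t := t) hC
  have hsymm : IsSymmSndFDerivAt ℝ U (x, t) := hC.isSymmSndFDerivAt (by simp)
  have hs := hsymm.eq (1, 0) (0, 1)
  rw [hx, ht]
  have e1 : ((-σ, 1) : ℝ × ℝ) = (-σ) • ((1, 0) : ℝ × ℝ) + ((0, 1) : ℝ × ℝ) := by simp
  have e2 : ((σ, 1) : ℝ × ℝ) = σ • ((1, 0) : ℝ × ℝ) + ((0, 1) : ℝ × ℝ) := by simp
  rw [map_zero, add_zero, e1, e2]
  generalize fderiv ℝ (fderiv ℝ U) (x, t) = Q at *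
  simp only [map_add, map_smul, add_apply, smul_apply,
    smul_eq_mul, hs]
  linear_combination (-(Q (1, 0) (1, 0))) * hσ

theorem isOpen_lt_time (T : ℝ≥0∞) : IsOpen {q : ℝ × ℝ | ENNReal.ofReal q.2 < T} :=
  isOpen_lt (ENNReal.continuous_ofReal.comp continuous_snd) continuous_const

theorem convex_slab (T : ℝ≥0∞) : Convex ℝ (slab T) := by
  have h : OrdConnected {t : ℝ | 0 ≤ t ∧ ENNReal.ofReal t < T} :=
    ⟨fun x hx y hy z hz => ⟨hx.1.trans hz.1, (ENNReal.ofReal_le_ofReal hz.2).trans_lt hy.2⟩⟩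
  exact h.convex.linear_preimage (LinearMap.snd ℝ ℝ ℝ)

theorem slab_mem_nhds {T : ℝ≥0∞} {q : ℝ × ℝ} (h0 : 0 < q.2) (hT : ENNReal.ofReal q.2 < T) :
    slab T ∈ 𝓝 q := by
  filter_upwards [(isOpen_lt continuous_const continuous_snd).mem_nhds h0,
    (isOpen_lt_time T).mem_nhds hT] with r h1 h2
  exact ⟨le_of_lt h1, h2⟩

theorem exists_pos_ofReal_lt {T : ℝ≥0∞} (hT : 0 < T) : ∃ t : ℝ, 0 < t ∧ ENNReal.ofReal t < T := by
  obtain ⟨r, -, h1, h2⟩ := ENNReal.lt_iff_exists_real_btwn.1 hT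
  exact ⟨r, ENNReal.ofReal_pos.1 h1, h2⟩

theorem uniqueDiffOn_slab {T : ℝ≥0∞} (hT : 0 < T) : UniqueDiffOn ℝ (slab T) := by
  obtain ⟨t, h0, h1⟩ := exists_pos_ofReal_lt hT
  exact uniqueDiffOn_convex (convex_slab T) ⟨(0, t), mem_interior_iff_mem_nhds.2 (slab_mem_nhds h0 h1)⟩

namespace IsClassicalSolution

variable {p a ε : ℝ} {f g : ℝ → ℝ} {T : ℝ≥0∞} {u : ℝ → ℝ → ℝ}

/-- The gradient is taken within the slab because `u` is regular only up to `t = 0`: it is then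
continuous down to the initial line, where it carries the data, and is the ordinary gradient for `t
> 0`. -/
theorem continuousOn_fderivWithin (h : IsClassicalSolution p a ε f g T u) (hT : 0 < T) :
    ContinuousOn (fderivWithin ℝ (fun q : ℝ × ℝ => u q.1 q.2) (slab T)) (slab T) :=
  h.contDiffOn.continuousOn_fderivWithin (uniqueDiffOn_slab hT) (by norm_num)

theorem hasFDerivWithinAt (h : IsClassicalSolution p a ε f g T u) {q : ℝ × ℝ} (hq : q ∈ slab T) :
    HasFDerivWithinAt (fun q : ℝ × ℝ => u q.1 q.2)
      (fderivWithin ℝ (fun q : ℝ × ℝ => u q.1 q.2) (slab T) q) (slab T) q :=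
  (h.contDiffOn.differentiableOn two_ne_zero q hq).hasFDerivWithinAt

theorem fderivWithin_initial (h : IsClassicalSolution p a ε f g T u) (hT : 0 < T) (x : ℝ) :
    fderivWithin ℝ (fun q : ℝ × ℝ => u q.1 q.2) (slab T) (x, 0) (1, 0) = deriv (fun y => ε * f y) x ∧
    fderivWithin ℝ (fun q : ℝ × ℝ => u q.1 q.2) (slab T) (x, 0) (0, 1) = ε * g x := by
  have hd := h.hasFDerivWithinAt (q := (x, 0)) ⟨le_rfl, by simpa using hT⟩
  constructor
  · have h1 : HasDerivAt (fun y : ℝ => (y, (0 : ℝ))) ((1 : ℝ), (0 : ℝ)) x :=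
      (hasDerivAt_id x).prodMk (hasDerivAt_const x 0)
    have h2 := HasFDerivWithinAt.comp_hasDerivWithinAt (s := univ)
      (f := fun y : ℝ => (y, (0 : ℝ))) x hd h1.hasDerivWithinAt
      (fun y _ => (⟨le_rfl, by simpa using hT⟩ : (y, (0 : ℝ)) ∈ slab T))
    rw [hasDerivWithinAt_univ] at h2
    rw [← h2.deriv]
    congr 1
    ext y
    exact h.initial_value y
  · have h1 : HasDerivAt (fun s : ℝ => (x, s)) ((0 : ℝ), (1 : ℝ)) 0 :=
      (hasDerivAt_const 0 x).prodMk (hasDerivAt_id 0)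
    have h2 := HasFDerivWithinAt.comp_hasDerivWithinAt (s := {s : ℝ | 0 ≤ s ∧ ENNReal.ofReal s < T})
      (f := fun s : ℝ => (x, s)) 0 hd h1.hasDerivWithinAt (fun s hs => hs)
    have h3 : {s : ℝ | 0 ≤ s ∧ ENNReal.ofReal s < T} ∈ 𝓝[Ici 0] (0 : ℝ) := by
      filter_upwards [self_mem_nhdsWithin, mem_nhdsWithin_of_mem_nhds
        ((isOpen_lt ENNReal.continuous_ofReal continuous_const).mem_nhds
          (by simpa using hT : ENNReal.ofReal 0 < T))] with s h1 h2
      exact ⟨h1, h2⟩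
    have h4 := (h2.mono_of_mem_nhdsWithin h3).derivWithin (uniqueDiffOn_Ici (0 : ℝ) 0 self_mem_Ici)
    rw [← h4]
    exact h.initial_velocity x

theorem hasDerivAt_characteristic (h : IsClassicalSolution p a ε f g T u) {σ : ℝ} (hσ : σ ^ 2 = 1)
    {x t : ℝ} (h0 : 0 < t) (hT : ENNReal.ofReal t < T) :
    HasDerivAt (fun s => fderivWithin ℝ (fun q : ℝ × ℝ => u q.1 q.2) (slab T)
        (x + σ * (t - s), s) (σ, 1))
      (|fderivWithin ℝ (fun q : ℝ × ℝ => u q.1 q.2) (slab T) (x, t) (1, 0)| ^ p / bracket x ^ a) t := by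
  have hC : ContDiffAt ℝ 2 (fun q : ℝ × ℝ => u q.1 q.2) (x, t) :=
    h.contDiffOn.contDiffAt (slab_mem_nhds h0 hT)
  have hev : fderivWithin ℝ (fun q : ℝ × ℝ => u q.1 q.2) (slab T) =ᶠ[𝓝 (x, t)]
      fderiv ℝ (fun q : ℝ × ℝ => u q.1 q.2) := by
    filter_upwards [(isOpen_lt continuous_const continuous_snd).mem_nhds h0,
      (isOpen_lt_time T).mem_nhds hT] with r h1 h2
    exact fderivWithin_of_mem_nhds (slab_mem_nhds h1 h2)
  have heq := h.equation x t h0 hT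
  rw [(hasDerivAt_slice hC).deriv, ← hev.eq_of_nhds] at heq
  exact (hasDerivAt_fderiv_characteristic hC hev hσ).congr_deriv heq

end IsClassicalSolution

/-- Both `(C/l) e^{ls} - y` and `(C/l) e^{ls} + y` are nondecreasing. The factor `1/l` is the gain
that closes the uniqueness argument. Derivatives are needed only in the open interval, since the
equation holds only for `t > 0`. -/
theorem abs_le_of_abs_deriv_le_exp {y y' : ℝ → ℝ} {t C l : ℝ} (ht : 0 ≤ t) (hl : 0 < l) (hC : 0 ≤ C)
    (hc : ContinuousOn y (Icc 0 t)) (hd : ∀ s ∈ Ioo 0 t, HasDerivAt y (y' s) s)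
    (hb : ∀ s ∈ Ioo 0 t, |y' s| ≤ C * Real.exp (l * s)) (h0 : y 0 = 0) :
    |y t| ≤ C / l * Real.exp (l * t) := by
  have key {y y' : ℝ → ℝ} (hc : ContinuousOn y (Icc 0 t)) (hd : ∀ s ∈ Ioo 0 t, HasDerivAt y (y' s) s)
      (hb : ∀ s ∈ Ioo 0 t, y' s ≤ C * Real.exp (l * s)) (h0 : y 0 = 0) :
      y t ≤ C / l * Real.exp (l * t) := by
    have hD (s) (hs : s ∈ Ioo 0 t) : HasDerivAt (fun s => C / l * Real.exp (l * s) - y s)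
        (C * Real.exp (l * s) - y' s) s := by
      refine ((((hasDerivAt_id s).const_mul l).exp.const_mul (C / l)).fun_sub (hd s hs)).congr_deriv ?_
      simp only [id]
      field_simp
    have hm : MonotoneOn (fun s => C / l * Real.exp (l * s) - y s) (Icc 0 t) := by
      refine monotoneOn_of_deriv_nonneg (convex_Icc 0 t)
        ((by fun_prop : Continuous fun s => C / l * Real.exp (l * s)).continuousOn.sub hc) ?_ ?_
      · rw [interior_Icc]
        exact fun s hs => (hD s hs).differentiableAt.differentiableWithinAt
      · rw [interior_Icc]
        intro s hs
        rw [(hD s hs).deriv]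
        linarith [hb s hs]
    have := hm (left_mem_Icc.2 ht) (right_mem_Icc.2 ht) ht
    simp only [mul_zero, Real.exp_zero, mul_one, h0, sub_zero] at this
    have : 0 ≤ C / l := by positivity
    linarith
  refine abs_le'.2 ⟨key hc hd (fun s hs => (le_abs_self _).trans (hb s hs)) h0, ?_⟩
  exact key (y := fun s => -y s) (y' := fun s => -y' s) hc.neg (fun s hs => (hd s hs).fun_neg)
    (fun s hs => (neg_le_abs _).trans (hb s hs)) (by simp [h0])

theorem bracket_pos (x : ℝ) : 0 < bracket x := Real.sqrt_pos.2 (by positivity)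

theorem continuous_bracket_rpow (b : ℝ) : Continuous fun x => bracket x ^ b := by
  refine Continuous.rpow_const ?_ fun x => Or.inl (bracket_pos x).ne'
  unfold bracket
  fun_prop

/-- On a compact backward cone the slopes are bounded, so the source is Lipschitz there with
constant `κ Λ`. Weighting the invariants of the difference by `e^{-lt}` and integrating along
characteristics, which stay in the cone, bounds the maximum of the weighted difference by `κ Λ / l <
1` times itself. -/
theorem IsClassicalSolution.fderivWithin_eq {p a ε : ℝ} {f g : ℝ → ℝ} {T : ℝ≥0∞} {u v : ℝ → ℝ → ℝ}
    (hp : 1 < p) (hu : IsClassicalSolution p a ε f g T u) (hv : IsClassicalSolution p a ε f g T v)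
    (hT : 0 < T) {q₀ : ℝ × ℝ} (hq₀ : q₀ ∈ slab T) :
    fderivWithin ℝ (fun q : ℝ × ℝ => u q.1 q.2) (slab T) q₀ =
      fderivWithin ℝ (fun q : ℝ × ℝ => v q.1 q.2) (slab T) q₀ := by
  have cU := hu.continuousOn_fderivWithin hT
  have cV := hv.continuousOn_fderivWithin hT
  have dU (σ : ℝ) (hσ : σ ^ 2 = 1) (x t : ℝ) := hu.hasDerivAt_characteristic hσ (x := x) (t := t)
  have dV (σ : ℝ) (hσ : σ ^ 2 = 1) (x t : ℝ) := hv.hasDerivAt_characteristic hσ (x := x) (t := t)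
  have iU := hu.fderivWithin_initial hT
  have iV := hv.fderivWithin_initial hT
  generalize fderivWithin ℝ (fun q : ℝ × ℝ => u q.1 q.2) (slab T) = LU at *
  generalize fderivWithin ℝ (fun q : ℝ × ℝ => v q.1 q.2) (slab T) = LV at *
  -- the backward light cone with vertex `q₀`
  set K : Set (ℝ × ℝ) := {q | 0 ≤ q.2 ∧ |q.1 - q₀.1| + q.2 ≤ q₀.2} with hK
  have hKS : K ⊆ slab T := fun q hq => ⟨hq.1, (ENNReal.ofReal_le_ofReal
    (by linarith [hq.2, abs_nonneg (q.1 - q₀.1)])).trans_lt hq₀.2⟩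
  have hKc : IsCompact K := by
    refine Metric.isCompact_of_isClosed_isBounded ((isClosed_le continuous_const continuous_snd).inter
      (isClosed_le (f := fun q : ℝ × ℝ => |q.1 - q₀.1| + q.2) (by fun_prop) continuous_const)) ?_
    refine (Metric.isBounded_closedBall (x := (q₀.1, (0 : ℝ))) (r := q₀.2)).subset fun q hq => ?_
    obtain ⟨h1, h2⟩ := hq
    rw [Metric.mem_closedBall, Prod.dist_eq, Real.dist_eq, Real.dist_eq]
    refine max_le ?_ ?_
    · linarith
    · rw [sub_zero, abs_of_nonneg h1]
      linarith [abs_nonneg (q.1 - q₀.1)]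
  have hq₀K : q₀ ∈ K := ⟨hq₀.1, by simp⟩
  have hray (σ : ℝ) (hσ : |σ| = 1) {q : ℝ × ℝ} (hq : q ∈ K) {s : ℝ} (hs : s ∈ Icc 0 q.2) :
      (q.1 + σ * (q.2 - s), s) ∈ K := by
    refine ⟨hs.1, ?_⟩
    have h1 := abs_add_le (q.1 - q₀.1) (σ * (q.2 - s))
    rw [abs_mul, hσ, one_mul, abs_of_nonneg (sub_nonneg.2 hs.2)] at h1
    have h2 := hq.2
    simp only
    rw [add_sub_right_comm]
    linarith
  have cU1 : ContinuousOn (fun q => LU q (1, 0)) K := (cU.mono hKS).clm_apply continuousOn_const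
  have cV1 : ContinuousOn (fun q => LV q (1, 0)) K := (cV.mono hKS).clm_apply continuousOn_const
  obtain ⟨M₁, hM₁⟩ := hKc.exists_bound_of_continuousOn cU1
  obtain ⟨M₂, hM₂⟩ := hKc.exists_bound_of_continuousOn cV1
  obtain ⟨κ, hκ⟩ := hKc.exists_bound_of_continuousOn
    (((continuous_bracket_rpow a).comp continuous_fst).inv₀
      fun q => (Real.rpow_pos_of_pos (bracket_pos _) a).ne').continuousOn
  have hκ0 : 0 ≤ κ := (norm_nonneg _).trans (hκ q₀ hq₀K)
  have hψ : ContDiff ℝ 1 fun s : ℝ => |s| ^ p := contDiff_norm_rpow hp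
  obtain ⟨Λ, hΛ⟩ := (isCompact_closedBall (0 : ℝ) (max M₁ M₂)).exists_bound_of_continuousOn
    (hψ.continuous_deriv le_rfl).continuousOn
  have hΛ0 : 0 ≤ Λ := (norm_nonneg _).trans (hΛ 0 (by
    simpa using Or.inl ((norm_nonneg _).trans (hM₁ q₀ hq₀K))))
  have hlip {q : ℝ × ℝ} (hq : q ∈ K) :
      |(|LU q (1, 0)| ^ p / bracket q.1 ^ a - |LV q (1, 0)| ^ p / bracket q.1 ^ a)| ≤
        κ * Λ * |LU q (1, 0) - LV q (1, 0)| := by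
    have h1 := (convex_closedBall (0 : ℝ) (max M₁ M₂)).norm_image_sub_le_of_norm_deriv_le
      (fun x _ => hψ.differentiable one_ne_zero x) hΛ
      (x := LV q (1, 0)) (y := LU q (1, 0))
      (by simpa using Or.inr (hM₂ q hq)) (by simpa using Or.inl (hM₁ q hq))
    have h2 := hκ q hq
    rw [← sub_div, div_eq_mul_inv, abs_mul, mul_comm, mul_assoc]
    exact mul_le_mul h2 h1 (abs_nonneg _) hκ0
  -- Any positive `l > κ Λ` would do.
  set l := 2 * (κ * Λ) + 1 with hl
  have hl0 : 0 < l := by positivity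
  -- the weighted maximum of the Riemann invariants of the difference
  set E : ℝ × ℝ → ℝ := fun q => max |LU q (1, 1) - LV q (1, 1)| |LU q (-1, 1) - LV q (-1, 1)| *
    Real.exp (-(l * q.2)) with hE
  have cL (e : ℝ × ℝ) : ContinuousOn (fun q => LU q e - LV q e) K :=
    ((cU.mono hKS).clm_apply continuousOn_const).sub ((cV.mono hKS).clm_apply continuousOn_const)
  obtain ⟨q₁, hq₁, hmax⟩ := hKc.exists_isMaxOn ⟨q₀, hq₀K⟩ (f := E)
    (((cL (1, 1)).abs.sup (cL (-1, 1)).abs).mul (by fun_prop))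
  have hE0 : 0 ≤ E q₁ := mul_nonneg (le_max_of_le_left (abs_nonneg _)) (Real.exp_pos _).le
  have hbd {q : ℝ × ℝ} (hq : q ∈ K) :
      max |LU q (1, 1) - LV q (1, 1)| |LU q (-1, 1) - LV q (-1, 1)| ≤ E q₁ * Real.exp (l * q.2) := by
    have h1 : E q ≤ E q₁ := hmax hq
    have h2 := mul_le_mul_of_nonneg_right h1 (Real.exp_pos (l * q.2)).le
    simp only [hE] at h2 ⊢
    rwa [mul_assoc, ← Real.exp_add, neg_add_cancel, Real.exp_zero, mul_one] at h2
  have hx {q : ℝ × ℝ} (hq : q ∈ K) :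
      |LU q (1, 0) - LV q (1, 0)| ≤ E q₁ * Real.exp (l * q.2) := by
    have e : ((1, 0) : ℝ × ℝ) = (1 / 2 : ℝ) • ((1, 1) : ℝ × ℝ) - (1 / 2 : ℝ) • ((-1, 1) : ℝ × ℝ) := by
      ext <;> norm_num
    have e2 : LU q (1, 0) - LV q (1, 0) = ((LU q (1, 1) - LV q (1, 1)) - (LU q (-1, 1) - LV q (-1, 1))) / 2 := by
      rw [e]
      simp only [map_sub, map_smul, smul_eq_mul]
      ring
    rw [e2, abs_div, abs_two, div_le_iff₀ two_pos]
    have := abs_sub (LU q (1, 1) - LV q (1, 1)) (LU q (-1, 1) - LV q (-1, 1))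
    have := max_le_iff.1 (hbd hq)
    linarith
  have himp (σ : ℝ) (hσ : |σ| = 1) {q : ℝ × ℝ} (hq : q ∈ K) :
      |LU q (σ, 1) - LV q (σ, 1)| ≤ κ * Λ * E q₁ / l * Real.exp (l * q.2) := by
    have hσ2 : σ ^ 2 = 1 := by rw [← sq_abs, hσ, one_pow]
    have hpath : (fun s => (q.1 + σ * (q.2 - s), s)) q.2 = q := by simp
    have := abs_le_of_abs_deriv_le_exp
      (y := fun s => LU (q.1 + σ * (q.2 - s), s) (σ, 1) - LV (q.1 + σ * (q.2 - s), s) (σ, 1))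
      (y' := fun s => |LU (q.1 + σ * (q.2 - s), s) (1, 0)| ^ p / bracket (q.1 + σ * (q.2 - s)) ^ a -
        |LV (q.1 + σ * (q.2 - s), s) (1, 0)| ^ p / bracket (q.1 + σ * (q.2 - s)) ^ a)
      hq.1 hl0 (by positivity : 0 ≤ κ * Λ * E q₁)
      ((cL (σ, 1)).comp (by fun_prop) fun s hs => hray σ hσ hq hs)
      (fun s hs => by
        have hmem := hKS (hray σ hσ hq (Ioo_subset_Icc_self hs))
        have h1 := dU σ hσ2 (q.1 + σ * (q.2 - s)) s hs.1 hmem.2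
        have h2 := dV σ hσ2 (q.1 + σ * (q.2 - s)) s hs.1 hmem.2
        have e (r : ℝ) : q.1 + σ * (q.2 - s) + σ * (s - r) = q.1 + σ * (q.2 - r) := by ring
        simp only [e] at h1 h2
        exact h1.fun_sub h2)
      (fun s hs => by
        have hmem := hray σ hσ hq (Ioo_subset_Icc_self hs)
        rw [mul_assoc (κ * Λ)]
        exact (hlip hmem).trans (by gcongr; exact hx hmem))
      (by
        have e : ((σ, 1) : ℝ × ℝ) = σ • ((1, 0) : ℝ × ℝ) + ((0, 1) : ℝ × ℝ) := by simp
        simp only [e, map_add, map_smul]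
        rw [(iU _).1, (iU _).2, (iV _).1, (iV _).2, sub_self])
    simpa using this
  have hE1 : E q₁ ≤ κ * Λ * E q₁ / l := by
    have h1 := max_le (himp 1 (by simp) hq₁) (himp (-1) (by simp) hq₁)
    have h2 := mul_le_mul_of_nonneg_right h1 (Real.exp_pos (-(l * q₁.2))).le
    rwa [mul_assoc, ← Real.exp_add, add_neg_cancel, Real.exp_zero, mul_one] at h2
  have hE2 : E q₁ = 0 := by
    rw [le_div_iff₀ hl0, hl] at hE1
    have : 0 ≤ κ * Λ * E q₁ := by positivity
    nlinarith
  have hz := hbd hq₀K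
  rw [hE2, zero_mul, max_le_iff, abs_nonpos_iff, abs_nonpos_iff, sub_eq_zero, sub_eq_zero] at hz
  refine ContinuousLinearMap.ext fun y => ?_
  have e : y = ((y.1 + y.2) / 2) • ((1, 1) : ℝ × ℝ) + ((y.2 - y.1) / 2) • ((-1, 1) : ℝ × ℝ) := by
    ext
    · simp only [Prod.fst_add, Prod.smul_fst, smul_eq_mul]; ring
    · simp only [Prod.snd_add, Prod.smul_snd, smul_eq_mul]; ring
  rw [e, map_add, map_add, map_smul, map_smul, map_smul, map_smul, hz.1, hz.2]

theorem IsClassicalSolution.unique {p a ε : ℝ} {f g : ℝ → ℝ} {T : ℝ≥0∞} {u v : ℝ → ℝ → ℝ}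
    (hp : 1 < p) (hu : IsClassicalSolution p a ε f g T u) (hv : IsClassicalSolution p a ε f g T v)
    (x t : ℝ) (ht : 0 ≤ t) (htT : ENNReal.ofReal t < T) : u x t = v x t := by
  have hT : 0 < T := (zero_le).trans_lt htT
  have h0 : ((0, 0) : ℝ × ℝ) ∈ slab T := ⟨le_rfl, by simpa using hT⟩
  exact (convex_slab T).eqOn_of_fderivWithin_eq
    (hu.contDiffOn.differentiableOn two_ne_zero) (hv.contDiffOn.differentiableOn two_ne_zero)
    (uniqueDiffOn_slab hT) (fun q hq => hu.fderivWithin_eq hp hv hT hq) h0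
    ((hu.initial_value 0).trans (hv.initial_value 0).symm) (show (x, t) ∈ slab T from ⟨ht, htT⟩)

/-! ### Existence for the original equation. -/

/-- A `C¹` function can be modified outside `[-M, M]` so that bounds for its derivative on this
interval become global. -/
theorem exists_truncation {ψ : ℝ → ℝ} (hψ : ContDiff ℝ 1 ψ) (hψ0 : ψ 0 = 0) {M Λ : ℝ} (hM : 0 ≤ M)
    (hΛ : ∀ s, |s| ≤ M → |deriv ψ s| ≤ Λ) :
    ∃ φ : ℝ → ℝ, ContDiff ℝ 1 φ ∧ φ 0 = 0 ∧ (∀ s, |deriv φ s| ≤ Λ) ∧ ∀ s, |s| ≤ M → φ s = ψ s := by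
  have hc : Continuous (deriv ψ) := hψ.continuous_deriv le_rfl
  have hcc : Continuous fun r => deriv ψ (max (-M) (min r M)) := by fun_prop
  have hd (s : ℝ) : HasDerivAt (fun s => ∫ r in (0 : ℝ)..s, deriv ψ (max (-M) (min r M)))
      (deriv ψ (max (-M) (min s M))) s := (hcc.integral_hasStrictDerivAt 0 s).hasDerivAt
  refine ⟨fun s => ∫ r in (0 : ℝ)..s, deriv ψ (max (-M) (min r M)), ?_, by simp, fun s => ?_,
    fun s hs => ?_⟩
  · rw [contDiff_one_iff_deriv]
    refine ⟨fun s => (hd s).differentiableAt, ?_⟩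
    rwa [show deriv _ = _ from funext fun s => (hd s).deriv]
  · rw [(hd s).deriv]
    exact hΛ _ (abs_le.2 ⟨le_max_left _ _, max_le (by linarith) (min_le_right _ _)⟩)
  · have h1 : ∫ r in (0 : ℝ)..s, deriv ψ (max (-M) (min r M)) = ∫ r in (0 : ℝ)..s, deriv ψ r := by
      refine intervalIntegral.integral_congr fun r hr => ?_
      have hr' : |r| ≤ M := by
        have := abs_sub_left_of_mem_uIcc hr
        simp only [sub_zero] at this
        exact this.trans hs
      simp only [min_eq_left (abs_le.1 hr').2, max_eq_right (abs_le.1 hr').1]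
    simp only [h1]
    rw [intervalIntegral.integral_eq_sub_of_hasDerivAt
      (fun r _ => (hψ.differentiable one_ne_zero r).hasDerivAt) (hc.intervalIntegrable _ _), hψ0, sub_zero]

theorem abs_deriv_abs_rpow {p : ℝ} (hp : 1 < p) (s : ℝ) :
    |deriv (fun x : ℝ => |x| ^ p) s| = p * |s| ^ (p - 1) := by
  have := norm_fderiv_norm_id_rpow (E := ℝ) s hp
  rwa [← norm_deriv_eq_norm_fderiv] at this

/-- The bound `|u_x| ≤ 2εm` keeps the slope where the truncated power is the true one. Where `|x| >
t + R` the slope is zero and both right-hand sides vanish, so `k` must agree with the true weight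
only for `|x| ≤ t + R`. -/
theorem exists_isClassicalSolution {p a R ε m : ℝ} (hp : 1 < p) {f g k : ℝ → ℝ} (hf : ContDiff ℝ 2 f)
    (hg : ContDiff ℝ 1 g) (hfR : ∀ x, R < |x| → f x = 0) (hgR : ∀ x, R < |x| → g x = 0)
    (hfm : ∀ x, |deriv f x| ≤ m / 2) (hgm : ∀ x, |g x| ≤ m / 2) (hε : 0 < ε)
    (hkC : ContDiff ℝ 1 k) (hk : Integrable k) (hk' : Integrable (deriv k))
    (hsmall : p * (2 * (ε * m)) ^ (p - 1) * ∫ y, |k y| ≤ 1 / 2) {T : ℝ≥0∞}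
    (hkT : ∀ x t : ℝ, 0 < t → ENNReal.ofReal t < T → |x| ≤ t + R → k x = (bracket x ^ a)⁻¹) :
    ∃ u, IsClassicalSolution p a ε f g T u := by
  have hm : 0 ≤ m := by linarith [(abs_nonneg _).trans (hgm 0)]
  obtain ⟨φ, hφ, hφ0, hφΛ, hφe⟩ := exists_truncation (ψ := fun s : ℝ => |s| ^ p)
    (M := 2 * (ε * m)) (Λ := p * (2 * (ε * m)) ^ (p - 1)) (contDiff_norm_rpow hp)
    (by simp [Real.zero_rpow (by linarith : p ≠ 0)]) (by positivity) (fun s hs => by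
      rw [abs_deriv_abs_rpow hp]
      gcongr)
  obtain ⟨u, hu, heq, hu0, hu1, hub, huR⟩ := exists_semilinear_wave hkC hk hk' hφ hφ0 hφΛ hsmall
    (F := fun x => ε * f x) (G := fun x => ε * g x) (contDiff_const.mul hf) (contDiff_const.mul hg)
    (R := R) (fun x hx => by simp [hfR x hx]) (fun x hx => by simp [hgR x hx]) (m := ε * m)
    (fun x => by
      rw [deriv_const_mul_field, abs_mul, abs_of_pos hε, mul_div_assoc]
      exact mul_le_mul_of_nonneg_left (hfm x) hε.le)
    (fun x => by
      rw [abs_mul, abs_of_pos hε, mul_div_assoc]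
      exact mul_le_mul_of_nonneg_left (hgm x) hε.le)
  refine ⟨u, hu.contDiffOn, fun x t h0 hT => ?_, hu0, fun x => ?_⟩
  · rw [heq, hφe _ (hub x t), div_eq_mul_inv, mul_comm]
    by_cases hx : |x| ≤ t + R
    · rw [hkT x t h0 hT hx]
    · rw [huR x t (by rw [abs_of_pos h0]; linarith), abs_zero, Real.zero_rpow (by linarith)]
      simp
  · exact (hu1 x).hasDerivWithinAt.derivWithin (uniqueDiffOn_Ici (0 : ℝ) 0 self_mem_Ici)

/-! ### The weight and its integrals. -/

theorem inv_bracket_rpow (a x : ℝ) : (bracket x ^ a)⁻¹ = (1 + x ^ 2) ^ (-a / 2) := by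
  rw [bracket, Real.sqrt_eq_rpow, ← Real.rpow_mul (by positivity), ← Real.rpow_neg (by positivity)]
  congr 1
  ring

theorem contDiff_inv_bracket_rpow (a : ℝ) : ContDiff ℝ 1 fun x => (bracket x ^ a)⁻¹ := by
  simp_rw [inv_bracket_rpow]
  exact ContDiff.rpow_const_of_ne (by fun_prop) fun x => by positivity

theorem hasDerivAt_inv_bracket_rpow (a x : ℝ) :
    HasDerivAt (fun x => (bracket x ^ a)⁻¹) (-a * (x / (1 + x ^ 2)) * (bracket x ^ a)⁻¹) x := by
  simp_rw [inv_bracket_rpow]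
  have h0 : (0 : ℝ) < 1 + x ^ 2 := by positivity
  have h1 : HasDerivAt (fun x : ℝ => 1 + x ^ 2) (2 * x) x := by
    simpa using (hasDerivAt_pow 2 x).const_add 1
  refine (h1.rpow_const (p := -a / 2) (Or.inl h0.ne')).congr_deriv ?_
  rw [Real.rpow_sub h0, Real.rpow_one]
  field_simp

theorem inv_bracket_rpow_pos (a x : ℝ) : 0 < (bracket x ^ a)⁻¹ :=
  inv_pos.2 (Real.rpow_pos_of_pos (bracket_pos x) a)

theorem integrable_inv_bracket_rpow {a : ℝ} (ha : 1 < a) : Integrable fun x => (bracket x ^ a)⁻¹ := by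
  simp_rw [inv_bracket_rpow]
  simpa using integrable_rpow_neg_one_add_norm_sq (E := ℝ) (μ := volume) (r := a) (by simpa using ha)

theorem integrable_deriv_inv_bracket_rpow {a : ℝ} (ha : 1 < a) :
    Integrable (deriv fun x => (bracket x ^ a)⁻¹) := by
  refine ((integrable_inv_bracket_rpow ha).const_mul a).mono'
    ((contDiff_inv_bracket_rpow a).continuous_deriv le_rfl).aestronglyMeasurable
    (Eventually.of_forall fun x => ?_)
  rw [(hasDerivAt_inv_bracket_rpow a x).deriv, Real.norm_eq_abs, abs_mul, abs_mul, abs_neg,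
    abs_of_pos (inv_bracket_rpow_pos a x), abs_of_pos (by linarith : 0 < a), abs_div,
    abs_of_pos (by positivity : 0 < 1 + x ^ 2)]
  have : |x| / (1 + x ^ 2) ≤ 1 := by
    rw [div_le_one (by positivity), ← sq_abs]
    nlinarith [sq_nonneg (|x| - 1)]
  have := mul_le_mul_of_nonneg_left this (by linarith : 0 ≤ a)
  exact mul_le_mul_of_nonneg_right (by linarith) (inv_bracket_rpow_pos a x).le

/-- For `a ≤ 1` the weight is not integrable. A bump function equal to `1` on `|x| ≤ ρ` and
vanishing for `|x| ≥ 2ρ` repairs this, at the price of the integral over the doubled interval. -/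
theorem exists_cutoff_weight (a : ℝ) {ρ : ℝ} (hρ : 0 < ρ) :
    ∃ k : ℝ → ℝ, ContDiff ℝ 1 k ∧ Integrable k ∧ Integrable (deriv k) ∧
      (∀ x, |x| ≤ ρ → k x = (bracket x ^ a)⁻¹) ∧
      ∫ y, |k y| ≤ ∫ y in (-(2 * ρ))..(2 * ρ), (bracket y ^ a)⁻¹ := by
  let χ : ContDiffBump (0 : ℝ) := ⟨ρ, 2 * ρ, hρ, by linarith⟩
  have hC : ContDiff ℝ 1 fun x => (bracket x ^ a)⁻¹ * χ x :=
    (contDiff_inv_bracket_rpow a).mul χ.contDiff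
  have hs : HasCompactSupport fun x => (bracket x ^ a)⁻¹ * χ x := χ.hasCompactSupport.mul_left
  refine ⟨fun x => (bracket x ^ a)⁻¹ * χ x, hC, hC.continuous.integrable_of_hasCompactSupport hs,
    (hC.continuous_deriv le_rfl).integrable_of_hasCompactSupport hs.deriv, fun x hx => ?_, ?_⟩
  · simp only [χ.one_of_mem_closedBall (by simpa [χ] using hx : x ∈ Metric.closedBall 0 χ.rIn), mul_one]
  · have hle (y : ℝ) : |(bracket y ^ a)⁻¹ * χ y| ≤ (bracket y ^ a)⁻¹ := by
      rw [abs_mul, abs_of_pos (inv_bracket_rpow_pos a y), abs_of_nonneg χ.nonneg]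
      exact mul_le_of_le_one_right (inv_bracket_rpow_pos a y).le χ.le_one
    have hzero (y : ℝ) (hy : y ∉ Ioc (-(2 * ρ)) (2 * ρ)) : |(bracket y ^ a)⁻¹ * χ y| = 0 := by
      rw [χ.zero_of_le_dist, mul_zero, abs_zero]
      change 2 * ρ ≤ dist y 0
      rw [Real.dist_eq, sub_zero]
      by_contra! h
      exact hy ⟨(abs_lt.1 h).1, (abs_lt.1 h).2.le⟩
    rw [← setIntegral_eq_integral_of_forall_compl_eq_zero hzero,
      ← intervalIntegral.integral_of_le (by linarith)]
    exact intervalIntegral.integral_mono_on (by linarith)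
      (hC.continuous.abs.intervalIntegrable _ _)
      ((contDiff_inv_bracket_rpow a).continuous.intervalIntegrable _ _) fun y _ => hle y

/-- The derivative of `x ⟨x⟩^{-a}` is `⟨x⟩^{-a} (1 - a x²/⟨x⟩²)`, at least `min 1 (1 - a)` times the
weight, so boundary values control the integral. At the boundary `⟨r⟩` is comparable to `r` because
`r ≥ 1`; the constant `2^|a|` serves both signs of `a`. -/
theorem exists_integral_inv_bracket_le {a : ℝ} (ha : a < 1) :
    ∃ c > 0, ∀ r : ℝ, 1 ≤ r → ∫ y in (-r)..r, (bracket y ^ a)⁻¹ ≤ c * r ^ (1 - a) := by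
  have hμ : 0 < min 1 (1 - a) := lt_min one_pos (by linarith)
  have hd (x : ℝ) : HasDerivAt (fun x => x * (bracket x ^ a)⁻¹)
      ((bracket x ^ a)⁻¹ * (1 - a * (x ^ 2 / (1 + x ^ 2)))) x := by
    refine ((hasDerivAt_id x).fun_mul (hasDerivAt_inv_bracket_rpow a x)).congr_deriv ?_
    simp only [id]
    ring
  have hlow (x : ℝ) : min 1 (1 - a) * (bracket x ^ a)⁻¹ ≤
      (bracket x ^ a)⁻¹ * (1 - a * (x ^ 2 / (1 + x ^ 2))) := by
    rw [mul_comm]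
    refine mul_le_mul_of_nonneg_left ?_ (inv_bracket_rpow_pos a x).le
    have h0 : 0 ≤ x ^ 2 / (1 + x ^ 2) := by positivity
    have h1 : x ^ 2 / (1 + x ^ 2) ≤ 1 := by rw [div_le_one (by positivity)]; linarith
    rcases le_total a 0 with h | h
    · exact (min_le_left _ _).trans (by nlinarith)
    · exact (min_le_right _ _).trans (by nlinarith)
  have hcont : Continuous fun x => (bracket x ^ a)⁻¹ := (contDiff_inv_bracket_rpow a).continuous
  have hcont' : Continuous fun x => (bracket x ^ a)⁻¹ * (1 - a * (x ^ 2 / (1 + x ^ 2))) :=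
    hcont.mul (continuous_const.sub (continuous_const.mul
      (Continuous.div (by fun_prop) (by fun_prop) fun x => by positivity)))
  refine ⟨2 * 2 ^ |a| / min 1 (1 - a), by positivity, fun r hr => ?_⟩
  have hr0 : 0 < r := by linarith
  have h1 := intervalIntegral.integral_mono_on (μ := volume) (by linarith : -r ≤ r)
    ((hcont.const_mul (min 1 (1 - a))).intervalIntegrable _ _) (hcont'.intervalIntegrable _ _)
    fun x _ => hlow x
  rw [intervalIntegral.integral_const_mul, intervalIntegral.integral_eq_sub_of_hasDerivAt
    (fun x _ => hd x) (hcont'.intervalIntegrable _ _)] at h1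
  have h2 : (bracket r ^ a)⁻¹ ≤ 2 ^ |a| * r ^ (-a) := by
    have e : (1 + r ^ 2 : ℝ) = (1 + (r ^ 2)⁻¹) * r ^ 2 := by
      rw [add_mul, inv_mul_cancel₀ (by positivity), one_mul, add_comm]
    have e2 : (r ^ 2) ^ (-a / 2) = r ^ (-a) := by
      rw [← Real.rpow_natCast, ← Real.rpow_mul hr0.le]; congr 1; push_cast; ring
    rw [inv_bracket_rpow, e, Real.mul_rpow (by positivity) (by positivity), e2]
    gcongr
    have h3 : (r ^ 2)⁻¹ ≤ 1 := inv_le_one_of_one_le₀ (one_le_pow₀ hr)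
    have h4 : (1 : ℝ) ≤ 1 + (r ^ 2)⁻¹ := by linarith [(by positivity : 0 < (r ^ 2)⁻¹)]
    calc (1 + (r ^ 2)⁻¹) ^ (-a / 2) ≤ (1 + (r ^ 2)⁻¹) ^ |a| :=
          Real.rpow_le_rpow_of_exponent_le h4 (by linarith [neg_abs_le a, abs_nonneg a])
      _ ≤ 2 ^ |a| := Real.rpow_le_rpow (by linarith) (by linarith) (abs_nonneg a)
  have h3 : (bracket (-r) ^ a)⁻¹ = (bracket r ^ a)⁻¹ := by simp [bracket]
  rw [h3] at h1
  rw [div_mul_eq_mul_div, le_div_iff₀ hμ, mul_comm]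
  have h4 : r ^ (1 - a) = r * r ^ (-a) := by
    rw [sub_eq_add_neg, Real.rpow_add hr0, Real.rpow_one]
  rw [h4]
  nlinarith [mul_le_mul_of_nonneg_left h2 hr0.le]

theorem integral_inv_bracket_one_le {r : ℝ} (hr : 1 ≤ r) :
    ∫ y in (-r)..r, (bracket y ^ (1 : ℝ))⁻¹ ≤ 2 * Real.log (3 * r) := by
  simp only [Real.rpow_one, bracket]
  rw [intervalIntegral.integral_eq_sub_of_hasDerivAt (f := Real.arsinh)
    (fun x _ => Real.hasDerivAt_arsinh x)
    (by simpa [bracket] using (contDiff_inv_bracket_rpow 1).continuous.intervalIntegrable _ _),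
    Real.arsinh_neg]
  have : Real.arsinh r ≤ Real.log (3 * r) := by
    have hsq : √(1 + r ^ 2) ≤ 2 * r := by
      rw [Real.sqrt_le_left (by linarith)]
      nlinarith
    exact Real.log_le_log (by positivity) (by linarith)
  linarith

/-! ### Smallness conditions and the three lifespans. -/

theorem exists_forall_rpow_le {K s : ℝ} (hK : 0 < K) (hs : 0 < s) :
    ∃ ε₂ : ℝ, 0 < ε₂ ∧ ∀ ε : ℝ, 0 < ε → ε ≤ ε₂ → ε ^ s ≤ K := by
  refine ⟨K ^ s⁻¹, by positivity, fun ε h0 h1 => ?_⟩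
  calc ε ^ s ≤ (K ^ s⁻¹) ^ s := Real.rpow_le_rpow h0.le h1 hs.le
    _ = K := by rw [← Real.rpow_mul hK.le, inv_mul_cancel₀ hs.ne', Real.rpow_one]

theorem classicalSolutionExists_of_small {p a R ε m : ℝ} (hp : 1 < p) (hR : 1 ≤ R) {f g : ℝ → ℝ}
    (hf : ContDiff ℝ 2 f) (hg : ContDiff ℝ 1 g) (hfR : ∀ x, R < |x| → f x = 0)
    (hgR : ∀ x, R < |x| → g x = 0) (hfm : ∀ x, |deriv f x| ≤ m / 2) (hgm : ∀ x, |g x| ≤ m / 2)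
    (hε : 0 < ε) {τ : ℝ} (hτ : 0 < τ)
    (hsmall : p * (2 * m) ^ (p - 1) * ε ^ (p - 1) *
      ∫ y in (-(2 * (τ + R)))..(2 * (τ + R)), (bracket y ^ a)⁻¹ ≤ 1 / 2)
    {T : ℝ≥0∞} (hT : T ≤ ENNReal.ofReal τ) : ClassicalSolutionExists p a ε f g T := by
  have hm : 0 ≤ m := by linarith [(abs_nonneg _).trans (hgm 0)]
  obtain ⟨k, hkC, hk, hk', hke, hki⟩ := exists_cutoff_weight a (ρ := τ + R) (by linarith)
  refine ⟨exists_isClassicalSolution hp hf hg hfR hgR hfm hgm hε hkC hk hk' ?_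
    fun x t _ ht hx => hke x ?_, fun u v hu hv => hu.unique hp hv⟩
  · refine le_trans ?_ hsmall
    rw [show 2 * (ε * m) = 2 * m * ε by ring, Real.mul_rpow (by positivity) hε.le, ← mul_assoc]
    gcongr
  · have := (ENNReal.ofReal_lt_ofReal_iff hτ).1 (ht.trans_le hT)
    linarith

theorem theorem2p3 (p a R : ℝ) (hp : 1 < p) (hR : 1 ≤ R) (f g : ℝ → ℝ)
    (hf : ContDiff ℝ 2 f) (hg : ContDiff ℝ 1 g)
    (hfR : tsupport f ⊆ {x : ℝ | |x| ≤ R}) (hgR : tsupport g ⊆ {x : ℝ | |x| ≤ R}) :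
    ∃ ε₂ : ℝ, 0 < ε₂ ∧ ∃ C : ℝ, 0 < C ∧ ∀ ε : ℝ, 0 < ε → ε ≤ ε₂ →
      (a < 1 →
        (∀ T : ℝ≥0∞, 0 < T → T ≤ ENNReal.ofReal (C * ε ^ (-(p - 1) / (1 - a))) →
          ClassicalSolutionExists p a ε f g T) ∧
        ENNReal.ofReal (C * ε ^ (-(p - 1) / (1 - a))) ≤ lifespan p a ε f g) ∧
      (a = 1 →
        (∀ T : ℝ≥0∞, 0 < T → T ≤ ENNReal.ofReal (Real.exp (C * ε ^ (-(p - 1)))) →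
          ClassicalSolutionExists p a ε f g T) ∧
        ENNReal.ofReal (Real.exp (C * ε ^ (-(p - 1)))) ≤ lifespan p a ε f g) ∧
      (1 < a →
        (∀ T : ℝ≥0∞, 0 < T → ClassicalSolutionExists p a ε f g T) ∧
        lifespan p a ε f g = ∞) := by
  have hf0 (x : ℝ) (hx : R < |x|) : f x = 0 :=
    image_eq_zero_of_notMem_tsupport fun h => absurd (hfR h) (not_le.2 hx)
  have hg0 (x : ℝ) (hx : R < |x|) : g x = 0 :=
    image_eq_zero_of_notMem_tsupport fun h => absurd (hgR h) (not_le.2 hx)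
  have hcs {h : ℝ → ℝ} (h0 : ∀ x, R < |x| → h x = 0) : HasCompactSupport h :=
    HasCompactSupport.intro (isCompact_closedBall (0 : ℝ) R) fun x hx => h0 x (by simpa using hx)
  obtain ⟨m₁, hm₁⟩ := (hcs hf0).deriv.exists_bound_of_continuous
    (hf.continuous_deriv one_le_two)
  obtain ⟨m₂, hm₂⟩ := (hcs hg0).exists_bound_of_continuous hg.continuous
  -- Halves, because the initial invariants `g ± f'` are to be bounded by `m`; the summand `1` makes
  -- `m` positive even for zero data.
  obtain ⟨m, hm, hfm, hgm⟩ : ∃ m > 0, (∀ x, |deriv f x| ≤ m / 2) ∧ ∀ x, |g x| ≤ m / 2 := by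
    refine ⟨2 * (|m₁| + |m₂| + 1), by positivity, fun x => ?_, fun x => ?_⟩
    · have : |deriv f x| ≤ m₁ := hm₁ x
      linarith [le_abs_self m₁, abs_nonneg m₂]
    · have : |g x| ≤ m₂ := hm₂ x
      linarith [le_abs_self m₂, abs_nonneg m₁]
  set Q := p * (2 * m) ^ (p - 1) with hQ
  have hQ0 : 0 < Q := by positivity
  have hp1 : 0 < p - 1 := by linarith
  have hspan {ε : ℝ} {T : ℝ≥0∞} (hT : 0 < T) (h : ∀ T' : ℝ≥0∞, 0 < T' → T' ≤ T →
      ClassicalSolutionExists p a ε f g T') : T ≤ lifespan p a ε f g := le_sSup ⟨hT, h T hT le_rfl⟩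
  rcases lt_trichotomy a 1 with ha | ha | ha
  · obtain ⟨c, hc, hcb⟩ := exists_integral_inv_bracket_le ha
    have ha' : 0 < 1 - a := by linarith
    set σ := (p - 1) / (1 - a) with hσ
    have hσ0 : 0 < σ := by positivity
    -- The `4` appears because `2(τ + R) ≤ 4τ` once `R ≤ τ`, for `τ` the claimed existence time; the
    -- choice of `ε₂` with `K = C / R` ensures `R ≤ τ`.
    obtain ⟨C, hC, hCe⟩ : ∃ C : ℝ, 0 < C ∧ Q * c * (4 * C) ^ (1 - a) = 1 / 2 := by
      refine ⟨(1 / (2 * (Q * c))) ^ (1 - a)⁻¹ / 4, by positivity, ?_⟩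
      rw [mul_div_cancel₀ _ four_ne_zero, ← Real.rpow_mul (by positivity),
        inv_mul_cancel₀ ha'.ne', Real.rpow_one]
      field_simp
    obtain ⟨ε₂, hε₂, hsm⟩ := exists_forall_rpow_le (K := C / R) (by positivity) hσ0
    refine ⟨ε₂, hε₂, C, hC, fun ε hε hεε => ⟨fun _ => ?_, fun h => absurd h ha.ne,
      fun h => absurd h ha.not_gt⟩⟩
    have hτ : 0 < C * ε ^ (-(p - 1) / (1 - a)) := by positivity
    have hτe : -(p - 1) / (1 - a) = -σ := by rw [hσ, neg_div]
    have hRτ : R ≤ C * ε ^ (-(p - 1) / (1 - a)) := by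
      have := hsm ε hε hεε
      rw [hτe, Real.rpow_neg hε.le, ← div_eq_mul_inv, le_div_iff₀ (by positivity)]
      rw [le_div_iff₀ (by positivity)] at this
      linarith
    have hex (T : ℝ≥0∞) (_ : 0 < T) (hT : T ≤ ENNReal.ofReal (C * ε ^ (-(p - 1) / (1 - a)))) :
        ClassicalSolutionExists p a ε f g T := by
      refine classicalSolutionExists_of_small hp hR hf hg hf0 hg0 hfm hgm hε hτ ?_ hT
      have h1 := hcb (2 * (C * ε ^ (-(p - 1) / (1 - a)) + R)) (by linarith)
      have h2 : (2 * (C * ε ^ (-(p - 1) / (1 - a)) + R)) ^ (1 - a) ≤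
          (4 * C) ^ (1 - a) * ε ^ (-(p - 1)) := by
        calc _ ≤ (4 * C * ε ^ (-(p - 1) / (1 - a))) ^ (1 - a) := by
              exact Real.rpow_le_rpow (by positivity) (by linarith) ha'.le
          _ = _ := by
              rw [Real.mul_rpow (by positivity) (by positivity), ← Real.rpow_mul hε.le,
                div_mul_cancel₀ _ ha'.ne']
      have h3 : ε ^ (p - 1) * ε ^ (-(p - 1)) = 1 := by
        rw [← Real.rpow_add hε, add_neg_cancel, Real.rpow_zero]
      calc _ ≤ Q * ε ^ (p - 1) * (c * ((4 * C) ^ (1 - a) * ε ^ (-(p - 1)))) := by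
            gcongr
            exact h1.trans (by gcongr)
        _ = Q * c * (4 * C) ^ (1 - a) * (ε ^ (p - 1) * ε ^ (-(p - 1))) := by ring
        _ ≤ 1 / 2 := by rw [h3, hCe, mul_one]
    exact ⟨hex, hspan (ENNReal.ofReal_pos.2 hτ) hex⟩
  · subst ha
    have hL : 0 < Real.log (6 * (1 + R)) := Real.log_pos (by linarith)
    -- As `τ ≥ 1`, the logarithm splits into `log (6(1+R))` and `log τ`. This `ε₂` limits the first
    -- share to `1/4`; the constant `1/(8Q)` in the exponent makes the second exactly `1/4`.
    obtain ⟨ε₂, hε₂, hsm⟩ := exists_forall_rpow_le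
      (K := 1 / (8 * Q * Real.log (6 * (1 + R)))) (by positivity) hp1
    refine ⟨ε₂, hε₂, 1 / (8 * Q), by positivity, fun ε hε hεε => ⟨fun h => absurd h (lt_irrefl _),
      fun _ => ?_, fun h => absurd h (lt_irrefl _)⟩⟩
    set τ := Real.exp (1 / (8 * Q) * ε ^ (-(p - 1))) with hτ
    have hτ0 : 0 < τ := Real.exp_pos _
    have hτ1 : 1 ≤ τ := Real.one_le_exp (by positivity)
    have hex (T : ℝ≥0∞) (_ : 0 < T) (hT : T ≤ ENNReal.ofReal τ) :
        ClassicalSolutionExists p 1 ε f g T := by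
      refine classicalSolutionExists_of_small hp hR hf hg hf0 hg0 hfm hgm hε hτ0 ?_ hT
      have h1 := integral_inv_bracket_one_le (r := 2 * (τ + R)) (by linarith)
      have h2 : Real.log (3 * (2 * (τ + R))) ≤
          Real.log (6 * (1 + R)) + 1 / (8 * Q) * ε ^ (-(p - 1)) := by
        calc _ ≤ Real.log (6 * (1 + R) * τ) := Real.log_le_log (by positivity) (by nlinarith)
          _ = _ := by rw [Real.log_mul (by positivity) hτ0.ne', hτ, Real.log_exp]
      have h3 : ε ^ (p - 1) * ε ^ (-(p - 1)) = 1 := by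
        rw [← Real.rpow_add hε, add_neg_cancel, Real.rpow_zero]
      have h4 := hsm ε hε hεε
      rw [le_div_iff₀ (by positivity)] at h4
      calc _ ≤ Q * ε ^ (p - 1) *
            (2 * (Real.log (6 * (1 + R)) + 1 / (8 * Q) * ε ^ (-(p - 1)))) := by
            gcongr
            linarith
        _ = (ε ^ (p - 1) * (8 * Q * Real.log (6 * (1 + R)))) / 4 +
            (ε ^ (p - 1) * ε ^ (-(p - 1))) / 4 := by
            field_simp
            ring
        _ ≤ 1 / 2 := by rw [h3]; linarith
    exact ⟨hex, hspan (ENNReal.ofReal_pos.2 hτ0) hex⟩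
  · set I := ∫ y, |(bracket y ^ a)⁻¹| with hI
    have hI0 : 0 ≤ I := integral_nonneg fun _ => abs_nonneg _
    -- The weight and its derivative are integrable, so no cutoff is needed and smallness does not
    -- involve `T`.
    obtain ⟨ε₂, hε₂, hsm⟩ := exists_forall_rpow_le (K := 1 / (2 * Q * (I + 1))) (by positivity) hp1
    refine ⟨ε₂, hε₂, 1, one_pos, fun ε hε hεε => ⟨fun h => absurd h ha.not_gt,
      fun h => absurd h ha.ne', fun _ => ?_⟩⟩
    have hex (T : ℝ≥0∞) (_ : 0 < T) : ClassicalSolutionExists p a ε f g T := by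
      refine ⟨exists_isClassicalSolution hp hf hg hf0 hg0 hfm hgm hε (contDiff_inv_bracket_rpow a)
        (integrable_inv_bracket_rpow ha) (integrable_deriv_inv_bracket_rpow ha) ?_
        fun x t _ _ _ => rfl, fun u v hu hv => hu.unique hp hv⟩
      have h4 := hsm ε hε hεε
      rw [le_div_iff₀ (by positivity)] at h4
      rw [show 2 * (ε * m) = 2 * m * ε by ring, Real.mul_rpow (by positivity) hε.le, ← mul_assoc,
        ← hQ, ← hI]
      nlinarith [(by positivity : 0 < ε ^ (p - 1) * Q)]
    exact ⟨hex, top_le_iff.1 (hspan (by simp) fun T' h _ => hex T' h)⟩
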